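/- Let $n\ge 0$, let $m_1,\dots,m_n\ge 0$ and $d_1,\dots,d_n\ge 1$ be integers, and put $M=m_1+\dots+m_n$. Let $X=\mathrm{SV}_{(m_1,\dots,m_n)}(d_1,\dots,d_n)\subseteq\mathbb{P}_{\mathbb{C}}^{N-1}$, $N=\prod_{i=1}^n\binom{m_i+d_i}{d_i}$, be the Segre–Veronese variety, that is, the image of $\mathbb{P}_{\mathbb{C}}^{m_1}\times\dots\times\mathbb{P}_{\mathbb{C}}^{m_n}$ under the map sending $(\mathbf{x}_1,\dots,\mathbf{x}_n)$, $\mathbf{x}_i=[x_{i,0},\dots,x_{i,m_i}]$, to the vector of all monomials of multidegree $(d_1,\dots,d_n)$. Let $\mathcal{N}(X)$ be the set of all integers $\#(X\cap W)_{\mathbb{R}}$ (the number of real points of $X\cap W$), where $W\subseteq\mathbb{P}_{\mathbb{C}}^{N-1}$ ranges over the linear spaces of dimension $N-1-\dim X$ that are defined by real linear forms and intersect $X$ transversely (at every complex point of $X\cap W$, $X$ is smooth and its tangent space together with $W$ spans $\mathbb{P}_{\mathbb{C}}^{N-1}$). Write $\mathcal{N}(X)_{\max}$ and $\mathcal{N}(X)_{\min}$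 for the maximum and the minimum of $\mathcal{N}(X)$. Then: (i) $\displaystyle \mathcal{N}(X)_{\max}=\deg X=\frac{(m_1+\dots+m_n)!}{m_1!\cdots m_n!}\prod_{i=1}^n d_i^{m_i}$ (in particular this maximum exists); (ii) if $d_i$ is even for at least one $i$ with $m_i\ge 1$, then $\mathcal{N}(X)_{\min}=0$; (iii) if $d_1,\dots,d_n$ are all odd, and either $M$ is even and at least one of $m_1,\dots,m_n$ is odd, or $M$ is odd and at least two of $m_1,\dots,m_n$ are odd, then $\mathcal{N}(X)_{\min}=0$. Here $\dim X$ and $\deg X$ are the usual dimension and degree of a projective variety: $\dim X$ is the degree of its Hilbert polynomial, and $\deg X$ is $(\dim X)!$ times the leading coefficient of that polynomial. -/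

import Mathlib

open scoped LinearAlgebra.Projectivization

noncomputable section RealSolutionCounts

/-! Subsets `X` of the complex projective space `ℙ(ℂ^ι)`, `ι` a finite index set. -/

/-- The punctured affine cone over `X`: all representatives of points of `X`. -/
def affineCone {ι : Type} (X : Set (ℙ ℂ (ι → ℂ))) : Set (ι → ℂ) :=
  {v | ∃ hv : v ≠ 0, Projectivization.mk ℂ v hv ∈ X}

/-- The homogeneous vanishing ideal of `X`. As `ℂ` is infinite and the cone is stable under
nonzero scalars, a polynomial vanishes on the cone iff all its homogeneous components do. -/
def homogeneousVanishingIdeal {ι : Type} (X : Set (ℙ ℂ (ι → ℂ))) :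
    Ideal (MvPolynomial ι ℂ) :=
  MvPolynomial.vanishingIdeal ℂ (affineCone X)

/-- The Hilbert function of `X`: the dimension of the degree `k` part of the homogeneous
coordinate ring of `X`. -/
def hilbertFunction {ι : Type} (X : Set (ℙ ℂ (ι → ℂ))) (k : ℕ) : ℕ :=
  Module.finrank ℂ
    (MvPolynomial.homogeneousSubmodule ι ℂ k ⧸
      ((homogeneousVanishingIdeal X).restrictScalars ℂ).comap
        (MvPolynomial.homogeneousSubmodule ι ℂ k).subtype)

open Classical in
/-- The Hilbert polynomial of `X`: the polynomial that agrees with the Hilbert function in all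
large degrees. -/
def hilbertPolynomial {ι : Type} (X : Set (ℙ ℂ (ι → ℂ))) : Polynomial ℚ :=
  if h : ∃ P : Polynomial ℚ, ∀ᶠ k : ℕ in Filter.atTop,
      (hilbertFunction X k : ℚ) = P.eval (k : ℚ)
  then h.choose else 0

/-- The Hilbert polynomial is unique, so that the choice above is harmless. -/
theorem hilbertPolynomial_eq {ι : Type} (X : Set (ℙ ℂ (ι → ℂ))) (P : Polynomial ℚ)
    (hP : ∀ᶠ k : ℕ in Filter.atTop, (hilbertFunction X k : ℚ) = P.eval (k : ℚ)) :
    hilbertPolynomial X = P := by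
  have h : ∃ P : Polynomial ℚ, ∀ᶠ k : ℕ in Filter.atTop,
      (hilbertFunction X k : ℚ) = P.eval (k : ℚ) := ⟨P, hP⟩
  rw [hilbertPolynomial, dif_pos h]
  obtain ⟨K, hK⟩ := Filter.eventually_atTop.1 (h.choose_spec.and hP)
  refine Polynomial.eq_of_infinite_eval_eq _ _ ?_
  refine ((Set.Ici_infinite K).image
    (f := fun k : ℕ => (k : ℚ)) Nat.cast_injective.injOn).mono ?_
  rintro _ ⟨k, hk, rfl⟩
  exact (hK k hk).1.symm.trans (hK k hk).2

/-- The dimension of the projective variety `X`: the degree of its Hilbert polynomial. -/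
def varietyDim {ι : Type} (X : Set (ℙ ℂ (ι → ℂ))) : ℕ :=
  (hilbertPolynomial X).natDegree

/-- The degree of the projective variety `X`: `(dim X)!` times the leading coefficient of its
Hilbert polynomial. -/
def varietyDegree {ι : Type} (X : Set (ℙ ℂ (ι → ℂ))) : ℚ :=
  ((varietyDim X).factorial : ℚ) * (hilbertPolynomial X).leadingCoeff

/-- The affine cone over the embedded (Zariski) tangent space of `X` at the point
represented by `v`. -/
def coneTangentSpace {ι : Type} [Fintype ι] (X : Set (ℙ ℂ (ι → ℂ))) (v : ι → ℂ) :
    Submodule ℂ (ι → ℂ) where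
  carrier := {w | ∀ f ∈ homogeneousVanishingIdeal X,
    ∑ i, MvPolynomial.eval v (MvPolynomial.pderiv i f) * w i = 0}
  zero_mem' := by
    intro f _
    simp
  add_mem' := by
    intro a b ha hb f hf
    simp only [Pi.add_apply, mul_add, Finset.sum_add_distrib, ha f hf, hb f hf, add_zero]
  smul_mem' := by
    intro c a ha f hf
    simp only [Pi.smul_apply, smul_eq_mul, mul_left_comm _ c, ← Finset.mul_sum, ha f hf, mul_zero]

/-- A linear subspace of `ℂ^ι` (equivalently, a projective linear space) is real if it is
defined by real linear forms. -/
def IsRealLinearSpace {ι : Type} [Fintype ι] (W : Submodule ℂ (ι → ℂ)) : Prop :=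
  ∃ S : Set (ι → ℝ), ∀ v : ι → ℂ, v ∈ W ↔ ∀ a ∈ S, ∑ i, (a i : ℂ) * v i = 0

/-- `X` and the projectivization of `W` intersect transversely: at each of their (complex)
common points, `X` is smooth, and the tangent space of `X` and `W` together span the whole
space. -/
def IntersectsTransversely {ι : Type} [Fintype ι] (X : Set (ℙ ℂ (ι → ℂ)))
    (W : Submodule ℂ (ι → ℂ)) : Prop :=
  ∀ v ∈ affineCone X, v ∈ W →
    Module.finrank ℂ (coneTangentSpace X v) = varietyDim X + 1 ∧ coneTangentSpace X v ⊔ W = ⊤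

/-- A point of complex projective space is real if it has a representative with real
coordinates. -/
def IsRealPoint {ι : Type} (p : ℙ ℂ (ι → ℂ)) : Prop :=
  ∃ (u : ι → ℝ) (hu : (fun i => (u i : ℂ)) ≠ 0), p = Projectivization.mk ℂ (fun i => (u i : ℂ)) hu

/-- The real points of the intersection of `X` with the projectivization of `W`. -/
def realIntersection {ι : Type} (X : Set (ℙ ℂ (ι → ℂ))) (W : Submodule ℂ (ι → ℂ)) :
    Set (ℙ ℂ (ι → ℂ)) :=
  {p | p ∈ X ∧ p.submodule ≤ W ∧ IsRealPoint p}

/-- The set `𝒩(X)` of possible numbers of real points in the intersection of `X` with a real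
linear space of complementary dimension that intersects `X` transversely. A subspace `W` has
projective dimension `finrank W - 1`, so complementary dimension means
`finrank W + dim X = card ι`. -/
def possibleRealCounts {ι : Type} [Fintype ι] (X : Set (ℙ ℂ (ι → ℂ))) : Set ℕ :=
  {k | ∃ W : Submodule ℂ (ι → ℂ), IsRealLinearSpace W ∧
    Module.finrank ℂ W + varietyDim X = Fintype.card ι ∧
    IntersectsTransversely X W ∧ (realIntersection X W).encard = k}

/-- The exponents of the monomials of multidegree `(d₁, …, dₙ)` in groups of variables
`x_{i,0}, …, x_{i,mᵢ}`: families of exponent vectors of total degree `dᵢ`. -/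
abbrev MultidegreeExponent {n : ℕ} (m d : Fin n → ℕ) : Type :=
  (i : Fin n) → ↥(Finset.piAntidiag (Finset.univ : Finset (Fin (m i + 1))) (d i))

/-- The vector of all monomials of multidegree `(d₁, …, dₙ)`, evaluated at `x`. -/
def monomialVector {n : ℕ} (m d : Fin n → ℕ) (x : (i : Fin n) → Fin (m i + 1) → ℂ) :
    MultidegreeExponent m d → ℂ :=
  fun α => ∏ i, ∏ j, x i j ^ (α i : Fin (m i + 1) → ℕ) j

/-- The monomial map is well defined on projective points: some monomial is nonzero. -/
theorem monomialVector_ne_zero {n : ℕ} (m d : Fin n → ℕ)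
    (x : (i : Fin n) → Fin (m i + 1) → ℂ) (hx : ∀ i, x i ≠ 0) :
    monomialVector m d x ≠ 0 := by
  have h : ∀ i, ∃ j, x i j ≠ 0 := fun i => Function.ne_iff.1 (hx i)
  choose j hj using h
  intro h0
  have h1 := congrFun h0 (fun i => ⟨Pi.single (j i) (d i), by simp [Finset.mem_piAntidiag]⟩)
  simp only [monomialVector, Pi.zero_apply, Finset.prod_eq_zero_iff, Finset.mem_univ,
    true_and] at h1
  obtain ⟨i, l, hl⟩ := h1
  obtain ⟨h2, h3⟩ := pow_eq_zero_iff'.1 hl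
  rcases eq_or_ne l (j i) with rfl | hne
  · exact hj i h2
  · exact h3 (Pi.single_eq_of_ne hne _)

/-- The Segre–Veronese variety: the image of `ℙ^{m₁} × ⋯ × ℙ^{mₙ}` under the map given by all
monomials of multidegree `(d₁, …, dₙ)`. -/
def segreVeronese {n : ℕ} (m d : Fin n → ℕ) : Set (ℙ ℂ (MultidegreeExponent m d → ℂ)) :=
  {p | ∃ (x : (i : Fin n) → Fin (m i + 1) → ℂ) (hx : ∀ i, x i ≠ 0),
    p = Projectivization.mk ℂ (monomialVector m d x) (monomialVector_ne_zero m d x hx)}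

end RealSolutionCounts

/-!
The section `X ∩ W` is governed by `M = m₁ + ⋯ + mₙ` forms of multidegree `d` on
`ℙ^{m₁} × ⋯ × ℙ^{mₙ}`. Three things have to be known.

*Dimension and degree.* The forms of degree `k` on the ambient space restrict to `X` as the forms
of multidegree `k d` (`map_pullback_homogeneousSubmodule`), so the Hilbert function is
`∏ binom (mᵢ + k dᵢ) mᵢ` (`hilbertFunction_segreVeronese`), a polynomial of degree `M` with leading
coefficient `∏ dᵢ^{mᵢ} / mᵢ!`. Equations of monomial type show that the Zariski tangent spaces have
dimension `M + 1` and consist of the velocities of the parametrization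
(`exists_fderiv_coneParam_eq`, `finrank_coneTangentSpace`).

*The upper bound.* Let `W` be the common kernel of `f₁, …, f_M`, transverse to `X` at `r` points of
`X ∩ W`. Choose a linear form `f₀` that vanishes at none of them and a linear form `h` such that
`h / f₀` takes different values at them. By transversality `(f₀, …, f_M)` is a submersion on the
cone over `X` at each of the points, hence open there: all values near the base value are attained
near each of the `r` points, with `r` different values of `h`. Therefore no nontrivial polynomial
relation of degree `< r` in `h` holds among `f₀, …, f_M, h` on `X`, which gives
`r * binom (M + K) M ≤ ∏ binom (mᵢ + (K + r) dᵢ) mᵢ` for all `K`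
(`mul_choose_le_of_intersectsTransversely`). The limit `K → ∞` gives `r ≤ deg X`.

*The constructions.* Read a vector `xᵢ ∈ ℂ^{mᵢ+1}` as a polynomial of degree at most `mᵢ`; its
values at nodes `t` are linear forms, at most `mᵢ` of which vanish at a point if the nodes are
distinct. Take for each of `M` indices the product of such forms, `dᵢ` of them from each group `i`
(`NodeSystem`). At a common zero the count forces that exactly one linear form per index and exactly
`mᵢ` linear forms of group `i` vanish (`NodeSystem.card_zeros_and_unique`); consequently the zeros
are nondegenerate (`NodeSystem.map_coneTangentSpace`) and correspond to the assignments counted in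
`card_assignments`. The linear section is real as soon as conjugation permutes the families of
nodes. With real nodes all points are real. If `dᵢ` is even, let the nodes of each index in group
`i` form nonreal conjugate pairs: at a real point the forms of a pair would vanish together. If the
indices themselves are paired by conjugation, with at most one index left over, then at a real point
the vanishing forms of any group without the leftover index come in pairs, contradicting that `mᵢ`
is odd.
-/

/-! ### The Hilbert function -/

/-- The space of forms of multidegree `e` in the groups of variables `x_{i,0}, …, x_{i,mᵢ}`,
encoded as functions on the product of the affine spaces `ℂ^{mᵢ+1}`. -/
def multiForms {n : ℕ} (m e : Fin n → ℕ) :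
    Submodule ℂ (((i : Fin n) → Fin (m i + 1) → ℂ) → ℂ) :=
  Submodule.span ℂ (Set.range fun α : MultidegreeExponent m e => fun x => monomialVector m e x α)

/-- The monomials of a given multidegree are distinct characters of a multiplicative monoid, hence
linearly independent by Dedekind's lemma. -/
theorem linearIndependent_monomialVector {n : ℕ} (m e : Fin n → ℕ) :
    LinearIndependent ℂ
      (fun α : MultidegreeExponent m e => fun x => monomialVector m e x α) := by
  let φ : MultidegreeExponent m e → (((i : Fin n) → Fin (m i + 1) → ℂ) →* ℂ) := fun α =>
    { toFun := fun x => monomialVector m e x α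
      map_one' := by simp [monomialVector]
      map_mul' := by
        intro x y
        simp [monomialVector, mul_pow, Finset.prod_mul_distrib] }
  have hφ : Function.Injective φ := by
    intro α β h
    funext i
    apply Subtype.ext
    funext j
    have h1 := DFunLike.congr_fun h (Pi.mulSingle i (Pi.mulSingle j 2))
    have key : ∀ γ : MultidegreeExponent m e,
        φ γ (Pi.mulSingle i (Pi.mulSingle j 2)) = 2 ^ (γ i : Fin (m i + 1) → ℕ) j := by
      intro γ
      change (∏ i', ∏ j', (Pi.mulSingle i (Pi.mulSingle j 2) :
        (i : Fin n) → Fin (m i + 1) → ℂ) i' j' ^ (γ i' : Fin (m i' + 1) → ℕ) j') = _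
      rw [Finset.prod_eq_single i, Finset.prod_eq_single j]
      · simp
      · intro j' _ hj'
        simp [Pi.mulSingle_eq_of_ne hj']
      · simp
      · intro i' _ hi'
        simp [Pi.mulSingle_eq_of_ne hi']
      · simp
    rw [key, key] at h1
    have h2 : (2 : ℕ) ^ (α i : Fin (m i + 1) → ℕ) j = 2 ^ (β i : Fin (m i + 1) → ℕ) j := by
      exact_mod_cast h1
    exact Nat.pow_right_injective le_rfl h2
  exact (linearIndependent_monoidHom ((i : Fin n) → Fin (m i + 1) → ℂ) ℂ).comp φ hφ

theorem card_piAntidiag_univ_fin (k e : ℕ) :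
    (Finset.piAntidiag (Finset.univ : Finset (Fin (k + 1))) e).card = (k + e).choose k := by
  rw [← Finset.map_sym_eq_piAntidiag, Finset.card_map]
  have h : (Finset.univ : Finset (Fin (k + 1))).sym e = Finset.univ := by
    ext a; simp
  rw [h, Finset.card_univ, Sym.card_sym_eq_choose, Fintype.card_fin]
  rw [show k + 1 + e - 1 = k + e by omega, Nat.choose_symm_add]

theorem card_multidegreeExponent {n : ℕ} (m e : Fin n → ℕ) :
    Fintype.card (MultidegreeExponent m e) = ∏ i, (m i + e i).choose (m i) := by
  rw [Fintype.card_pi]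
  refine Finset.prod_congr rfl fun i _ => ?_
  rw [Fintype.card_coe, card_piAntidiag_univ_fin]

theorem finrank_multiForms {n : ℕ} (m e : Fin n → ℕ) :
    Module.finrank ℂ (multiForms m e) = ∏ i, (m i + e i).choose (m i) := by
  rw [multiForms, finrank_span_eq_card (linearIndependent_monomialVector m e),
    card_multidegreeExponent]

instance {n : ℕ} (m e : Fin n → ℕ) : FiniteDimensional ℂ (multiForms m e) :=
  FiniteDimensional.span_of_finite ℂ (Set.finite_range _)

theorem exists_le_sum_eq {k : ℕ} (f : Fin k → ℕ) (a : ℕ) (h : a ≤ ∑ i, f i) :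
    ∃ g : Fin k → ℕ, g ≤ f ∧ ∑ i, g i = a := by
  obtain ⟨g, hg, h1⟩ := Finsupp.exists_le_degree_eq (Finsupp.equivFunOnFinite.symm f) a
    (by simpa [Finsupp.degree_eq_sum] using h)
  exact ⟨g, fun i => by simpa using hg i, by simpa [Finsupp.degree_eq_sum] using h1⟩

theorem multiForms_mul {n : ℕ} (m e e' : Fin n → ℕ) :
    multiForms m e * multiForms m e' = multiForms m (e + e') := by
  apply le_antisymm
  · rw [multiForms, multiForms, Submodule.span_mul_span, Submodule.span_le]
    rintro _ ⟨_, ⟨α, rfl⟩, _, ⟨β, rfl⟩, rfl⟩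
    refine Submodule.subset_span ⟨fun i => ⟨(α i : Fin (m i + 1) → ℕ) + β i, ?_⟩, ?_⟩
    · have h1 := (Finset.mem_piAntidiag.1 (α i).2).1
      have h2 := (Finset.mem_piAntidiag.1 (β i).2).1
      simp [Finset.mem_piAntidiag, Finset.sum_add_distrib, h1, h2]
    · funext x
      simp [monomialVector, pow_add, Finset.prod_mul_distrib]
  · rw [multiForms, Submodule.span_le]
    rintro _ ⟨γ, rfl⟩
    have h : ∀ i, ∃ g : Fin (m i + 1) → ℕ, g ≤ (γ i : Fin (m i + 1) → ℕ) ∧ ∑ j, g j = e i := by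
      intro i
      apply exists_le_sum_eq
      rw [(Finset.mem_piAntidiag.1 (γ i).2).1]
      simp
    choose g hg hge using h
    have h1 : (fun x => monomialVector m (e + e') x γ) =
        (fun x => monomialVector m e x fun i => ⟨g i, by simp [Finset.mem_piAntidiag, hge]⟩) *
        (fun x => monomialVector m e' x fun i => ⟨(γ i : Fin (m i + 1) → ℕ) - g i, by
          have h2 := (Finset.mem_piAntidiag.1 (γ i).2).1
          have h3 := Finset.sum_tsub_distrib Finset.univ (fun j _ => hg i j)
          simp only [Finset.mem_piAntidiag, Pi.sub_apply, Finset.mem_univ, implies_true, and_true]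
          rw [h3, hge, h2]
          simp⟩) := by
      funext x
      simp only [monomialVector, Pi.mul_apply, ← Finset.prod_mul_distrib, ← pow_add]
      refine Finset.prod_congr rfl fun i _ => Finset.prod_congr rfl fun j _ => ?_
      rw [Pi.sub_apply, add_tsub_cancel_of_le (hg i j)]
    change (fun x => monomialVector m (e + e') x γ) ∈ _
    rw [h1]
    exact Submodule.mul_mem_mul (Submodule.subset_span ⟨_, rfl⟩) (Submodule.subset_span ⟨_, rfl⟩)

theorem multiForms_zero {n : ℕ} (m : Fin n → ℕ) : multiForms m 0 = 1 := by
  have h0 : ∀ α : MultidegreeExponent m 0, (fun x => monomialVector m 0 x α) = 1 := by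
    intro α
    funext x
    refine Finset.prod_eq_one fun i _ => Finset.prod_eq_one fun j _ => ?_
    have h : ∑ j, (α i : Fin (m i + 1) → ℕ) j = 0 := (Finset.mem_piAntidiag.1 (α i).2).1
    rw [Finset.sum_eq_zero_iff] at h
    rw [h j (Finset.mem_univ j), pow_zero]
  rw [multiForms, Submodule.one_eq_span]
  congr 1
  ext f
  constructor
  · rintro ⟨α, rfl⟩
    exact h0 α
  · rintro rfl
    exact ⟨fun i => ⟨0, by simp⟩, h0 _⟩

theorem multiForms_pow {n : ℕ} (m e : Fin n → ℕ) (k : ℕ) :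
    multiForms m e ^ k = multiForms m (k • e) := by
  induction k with
  | zero => rw [pow_zero, zero_smul, multiForms_zero]
  | succ k ih => rw [pow_succ, ih, multiForms_mul, succ_nsmul]

/-- Substitution of the monomials of multidegree `d` for the coordinates, as an algebra map into
functions of `x`. -/
noncomputable def pullback {n : ℕ} (m d : Fin n → ℕ) :
    MvPolynomial (MultidegreeExponent m d) ℂ →ₐ[ℂ] (((i : Fin n) → Fin (m i + 1) → ℂ) → ℂ) :=
  MvPolynomial.aeval fun α x => monomialVector m d x α

theorem pullback_apply {n : ℕ} (m d : Fin n → ℕ) (f : MvPolynomial (MultidegreeExponent m d) ℂ)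
    (x : (i : Fin n) → Fin (m i + 1) → ℂ) :
    pullback m d f x = MvPolynomial.eval (monomialVector m d x) f := by
  induction f using MvPolynomial.induction_on with
  | C a => simp [pullback]
  | add p q hp hq => simp [hp, hq]
  | mul_X p i hp => simp [hp]; simp [pullback]

/-- The forms of degree `k` restrict exactly to the forms of multidegree `k • d`. -/
theorem map_pullback_homogeneousSubmodule {n : ℕ} (m d : Fin n → ℕ) (k : ℕ) :
    (MvPolynomial.homogeneousSubmodule (MultidegreeExponent m d) ℂ k).map
      (pullback m d).toLinearMap = multiForms m (k • d) := by
  rw [← MvPolynomial.homogeneousSubmodule_one_pow, Submodule.map_pow, ← multiForms_pow]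
  congr 1
  rw [MvPolynomial.homogeneousSubmodule_one_eq_span_X, Submodule.map_span, ← Set.range_comp,
    multiForms]
  congr 2
  funext α x
  simp [pullback]

theorem continuous_monomialVector {n : ℕ} (m d : Fin n → ℕ) :
    Continuous (monomialVector m d) := by
  unfold monomialVector
  fun_prop

theorem dense_forall_ne_zero {n : ℕ} (m : Fin n → ℕ) :
    Dense {x : (i : Fin n) → Fin (m i + 1) → ℂ | ∀ i, x i ≠ 0} := by
  have h := dense_pi (Set.univ : Set (Fin n))
    (s := fun i => ({0}ᶜ : Set (Fin (m i + 1) → ℂ))) (fun i _ => dense_compl_singleton 0)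
  convert h using 1
  ext x
  simp

theorem MvPolynomial.IsHomogeneous.eval_smul_eq {ι : Type} [Fintype ι] {f : MvPolynomial ι ℂ}
    {k : ℕ} (hf : f.IsHomogeneous k) (c : ℂ) (v : ι → ℂ) :
    MvPolynomial.eval (c • v) f = c ^ k * MvPolynomial.eval v f := by
  rw [MvPolynomial.eval_eq', MvPolynomial.eval_eq', Finset.mul_sum]
  refine Finset.sum_congr rfl fun a ha => ?_
  have h : ∑ i, a i = k := by
    rw [← Finsupp.degree_eq_sum, Finsupp.degree_eq_weight_one]
    exact hf (MvPolynomial.mem_support_iff.1 ha)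
  simp only [Pi.smul_apply, smul_eq_mul, mul_pow, Finset.prod_mul_distrib]
  rw [Finset.prod_pow_eq_pow_sum, h]
  ring

theorem monomialVector_mem_affineCone {n : ℕ} (m d : Fin n → ℕ)
    (x : (i : Fin n) → Fin (m i + 1) → ℂ) (hx : ∀ i, x i ≠ 0) (c : ℂ) (hc : c ≠ 0) :
    c • monomialVector m d x ∈ affineCone (segreVeronese m d) := by
  refine ⟨smul_ne_zero hc (monomialVector_ne_zero m d x hx), x, hx, ?_⟩
  rw [Projectivization.mk_eq_mk_iff']
  exact ⟨c, rfl⟩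

theorem exists_of_mem_affineCone {n : ℕ} {m d : Fin n → ℕ} {v : MultidegreeExponent m d → ℂ}
    (hv : v ∈ affineCone (segreVeronese m d)) :
    ∃ (x : (i : Fin n) → Fin (m i + 1) → ℂ) (c : ℂ),
      (∀ i, x i ≠ 0) ∧ c ≠ 0 ∧ v = c • monomialVector m d x := by
  obtain ⟨hv0, x, hx, h⟩ := hv
  rw [Projectivization.mk_eq_mk_iff'] at h
  obtain ⟨c, hc⟩ := h
  refine ⟨x, c, hx, ?_, hc.symm⟩
  rintro rfl
  exact hv0 (by rw [← hc, zero_smul])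

/-- Polynomials in the ideal vanish on all the vectors `c • μ(x)`, including the degenerate ones
that do not represent a point. -/
theorem eval_smul_monomialVector_eq_zero {n : ℕ} {m d : Fin n → ℕ}
    {f : MvPolynomial (MultidegreeExponent m d) ℂ}
    (hf : f ∈ homogeneousVanishingIdeal (segreVeronese m d)) (c : ℂ)
    (x : (i : Fin n) → Fin (m i + 1) → ℂ) :
    MvPolynomial.eval (c • monomialVector m d x) f = 0 := by
  let S : Set (ℂ × ((i : Fin n) → Fin (m i + 1) → ℂ)) := {0}ᶜ ×ˢ {x | ∀ i, x i ≠ 0}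
  have hS : Dense S := (dense_compl_singleton 0).prod (dense_forall_ne_zero m)
  have hc : Continuous fun p : ℂ × ((i : Fin n) → Fin (m i + 1) → ℂ) =>
      MvPolynomial.eval (p.1 • monomialVector m d p.2) f :=
    (MvPolynomial.continuous_eval f).comp
      (continuous_fst.smul ((continuous_monomialVector m d).comp continuous_snd))
  have h := Continuous.ext_on hS hc continuous_const (g := fun _ => (0 : ℂ)) ?_
  · exact congrFun h (c, x)
  · rintro ⟨c, x⟩ ⟨h1, h2⟩
    have := hf _ (monomialVector_mem_affineCone m d x h2 c h1)
    rwa [MvPolynomial.aeval_eq_eval] at this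

theorem mem_homogeneousVanishingIdeal_iff_pullback {n : ℕ} (m d : Fin n → ℕ) {k : ℕ}
    {f : MvPolynomial (MultidegreeExponent m d) ℂ} (hf : f.IsHomogeneous k) :
    f ∈ homogeneousVanishingIdeal (segreVeronese m d) ↔ pullback m d f = 0 := by
  constructor
  · intro h
    funext x
    rw [pullback_apply]
    simpa using eval_smul_monomialVector_eq_zero h 1 x
  · intro h v hv
    obtain ⟨x, c, -, -, rfl⟩ := exists_of_mem_affineCone hv
    rw [MvPolynomial.aeval_eq_eval]
    have := congrFun h x
    rw [pullback_apply] at this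
    rw [hf.eval_smul_eq, this, Pi.zero_apply, mul_zero]

theorem hilbertFunction_segreVeronese {n : ℕ} (m d : Fin n → ℕ) (k : ℕ) :
    hilbertFunction (segreVeronese m d) k = ∏ i, (m i + k * d i).choose (m i) := by
  let H := MvPolynomial.homogeneousSubmodule (MultidegreeExponent m d) ℂ k
  let L : H →ₗ[ℂ] (((i : Fin n) → Fin (m i + 1) → ℂ) → ℂ) :=
    (pullback m d).toLinearMap.comp H.subtype
  have hker : ((homogeneousVanishingIdeal (segreVeronese m d)).restrictScalars ℂ).comap
      H.subtype = LinearMap.ker L := by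
    ext f
    simp only [Submodule.mem_comap, Submodule.restrictScalars_mem, LinearMap.mem_ker]
    exact mem_homogeneousVanishingIdeal_iff_pullback m d f.2
  rw [hilbertFunction]
  change Module.finrank ℂ (H ⧸ _) = _
  rw [hker, L.quotKerEquivRange.finrank_eq, LinearMap.range_comp, Submodule.range_subtype,
    map_pullback_homogeneousSubmodule, finrank_multiForms]
  rfl

open Polynomial in
/-- The polynomial in `k` with values `binom (m + k d) m`. -/
noncomputable def choosePolynomial (m d : ℕ) : ℚ[X] :=
  C ((m.factorial : ℚ)⁻¹) * (ascPochhammer ℚ m).comp (C (d : ℚ) * X + C 1)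

theorem eval_choosePolynomial (m d k : ℕ) :
    (choosePolynomial m d).eval (k : ℚ) = ((m + k * d).choose m : ℕ) := by
  have h : (d : ℚ) * k + 1 = ((k * d + 1 : ℕ) : ℚ) := by push_cast; ring
  simp only [choosePolynomial, Polynomial.eval_mul, Polynomial.eval_C, Polynomial.eval_comp,
    Polynomial.eval_add, Polynomial.eval_X]
  rw [h, ascPochhammer_nat_eq_natCast_ascFactorial, Nat.ascFactorial_eq_factorial_mul_choose]
  have : (m.factorial : ℚ) ≠ 0 := by exact_mod_cast m.factorial_ne_zero
  push_cast
  rw [inv_mul_cancel_left₀ this, add_comm m]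

theorem natDegree_choosePolynomial (m d : ℕ) (hd : 1 ≤ d) :
    (choosePolynomial m d).natDegree = m := by
  have hd' : (d : ℚ) ≠ 0 := by positivity
  have : ((m.factorial : ℚ)⁻¹) ≠ 0 := inv_ne_zero (by exact_mod_cast m.factorial_ne_zero)
  rw [choosePolynomial, Polynomial.natDegree_C_mul this, Polynomial.natDegree_comp,
    Polynomial.natDegree_linear hd', ascPochhammer_natDegree, mul_one]

theorem leadingCoeff_choosePolynomial (m d : ℕ) (hd : 1 ≤ d) :
    (choosePolynomial m d).leadingCoeff = (d : ℚ) ^ m / m.factorial := by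
  have hd' : (d : ℚ) ≠ 0 := by positivity
  rw [choosePolynomial, Polynomial.leadingCoeff_mul, Polynomial.leadingCoeff_C,
    Polynomial.leadingCoeff_comp (by rw [Polynomial.natDegree_linear hd']; simp),
    Polynomial.leadingCoeff_linear hd', (monic_ascPochhammer ℚ m).leadingCoeff,
    ascPochhammer_natDegree]
  ring

theorem hilbertPolynomial_segreVeronese {n : ℕ} (m d : Fin n → ℕ) :
    hilbertPolynomial (segreVeronese m d) = ∏ i, choosePolynomial (m i) (d i) := by
  apply hilbertPolynomial_eq
  refine Filter.Eventually.of_forall fun k => ?_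
  rw [hilbertFunction_segreVeronese, Polynomial.eval_prod]
  push_cast
  exact Finset.prod_congr rfl fun i _ => (eval_choosePolynomial _ _ _).symm

theorem varietyDim_segreVeronese {n : ℕ} (m d : Fin n → ℕ) (hd : ∀ i, 1 ≤ d i) :
    varietyDim (segreVeronese m d) = ∑ i, m i := by
  rw [varietyDim, hilbertPolynomial_segreVeronese, Polynomial.natDegree_prod]
  · exact Finset.sum_congr rfl fun i _ => natDegree_choosePolynomial _ _ (hd i)
  · intro i _ h
    have := leadingCoeff_choosePolynomial (m i) (d i) (hd i)
    rw [h, Polynomial.leadingCoeff_zero] at this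
    have h1 : (0 : ℚ) < (d i : ℚ) ^ m i / (m i).factorial := by
      have := hd i
      positivity
    exact h1.ne this

theorem varietyDegree_segreVeronese {n : ℕ} (m d : Fin n → ℕ) (hd : ∀ i, 1 ≤ d i) :
    varietyDegree (segreVeronese m d) =
      ((∑ i, m i).factorial : ℚ) / (∏ i, ((m i).factorial : ℚ)) * ∏ i, (d i : ℚ) ^ m i := by
  rw [varietyDegree, varietyDim_segreVeronese m d hd, hilbertPolynomial_segreVeronese,
    Polynomial.leadingCoeff_prod,
    Finset.prod_congr rfl fun i _ => leadingCoeff_choosePolynomial _ _ (hd i),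
    Finset.prod_div_distrib]
  ring

/-! ### Tangent spaces -/

/-- The parametrization `(c, x) ↦ c • μ(x)` of the affine cone over the Segre–Veronese variety. -/
noncomputable def coneParam {n : ℕ} (m d : Fin n → ℕ)
    (p : ℂ × ((i : Fin n) → Fin (m i + 1) → ℂ)) : MultidegreeExponent m d → ℂ :=
  p.1 • monomialVector m d p.2

theorem contDiff_coneParam {n : ℕ} (m d : Fin n → ℕ) : ContDiff ℂ 1 (coneParam m d) := by
  unfold coneParam monomialVector
  rw [contDiff_pi]
  intro α
  simp only [Pi.smul_apply, smul_eq_mul]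
  refine contDiff_fst.mul (contDiff_prod fun i _ => contDiff_prod fun j _ => ?_)
  exact (contDiff_pi.1 (contDiff_pi.1 contDiff_snd i) j).pow _

theorem hasStrictFDerivAt_coneParam {n : ℕ} (m d : Fin n → ℕ)
    (p : ℂ × ((i : Fin n) → Fin (m i + 1) → ℂ)) :
    HasStrictFDerivAt (coneParam m d) (fderiv ℂ (coneParam m d) p) p :=
  (contDiff_coneParam m d).contDiffAt.hasStrictFDerivAt one_ne_zero

theorem hasFDerivAt_mvPolynomial_eval {ι : Type} [Fintype ι] (f : MvPolynomial ι ℂ) (v : ι → ℂ) :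
    HasFDerivAt (fun v : ι → ℂ => MvPolynomial.eval v f)
      (∑ i, MvPolynomial.eval v (MvPolynomial.pderiv i f) •
        (ContinuousLinearMap.proj i : (ι → ℂ) →L[ℂ] ℂ)) v := by
  classical
  induction f using MvPolynomial.induction_on with
  | C a =>
    simp only [MvPolynomial.eval_C]
    refine (hasFDerivAt_const a v).congr_fderiv ?_
    ext w
    simp
  | add p q hp hq =>
    simp only [map_add]
    refine (hp.fun_add hq).congr_fderiv ?_
    ext w
    simp [add_mul, Finset.sum_add_distrib]
  | mul_X p j hp =>
    simp only [MvPolynomial.eval_mul, MvPolynomial.eval_X]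
    refine (hp.fun_mul (hasFDerivAt_apply j v)).congr_fderiv ?_
    ext w
    simp [Derivation.leibniz, MvPolynomial.pderiv_X, Pi.single_apply, add_mul,
      Finset.sum_add_distrib, Finset.mul_sum, mul_assoc, apply_ite]

/-- Tangent vectors of the parametrization lie in the Zariski tangent space. -/
theorem fderiv_coneParam_mem {n : ℕ} (m d : Fin n → ℕ)
    (p q : ℂ × ((i : Fin n) → Fin (m i + 1) → ℂ)) :
    fderiv ℂ (coneParam m d) p q ∈ coneTangentSpace (segreVeronese m d) (coneParam m d p) := by
  intro f hf
  have h1 := (hasFDerivAt_mvPolynomial_eval f (coneParam m d p)).comp p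
    (hasStrictFDerivAt_coneParam m d p).hasFDerivAt
  have h2 : ((fun v => MvPolynomial.eval v f) ∘ coneParam m d) = fun _ => 0 := by
    funext p
    exact eval_smul_monomialVector_eq_zero hf p.1 p.2
  rw [h2] at h1
  have h3 := DFunLike.congr_fun (h1.unique (hasFDerivAt_const 0 p)) q
  simpa using h3

/-- The exponent of the monomial `∏ᵢ x_{i,j(i)}^{dᵢ}`. -/
def baseExponent {n : ℕ} {m : Fin n → ℕ} (d : Fin n → ℕ) (j : (i : Fin n) → Fin (m i + 1)) :
    MultidegreeExponent m d :=
  fun i => ⟨Pi.single (j i) (d i), by simp [Finset.mem_piAntidiag]⟩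

/-- The exponent of the monomial `∏ᵢ x_{i,j(i)}^{dᵢ}` with one factor `x_{i,j(i)}` replaced by
`x_{i,s}`. -/
def neighborExponent {n : ℕ} {m d : Fin n → ℕ} (hd : ∀ i, 1 ≤ d i)
    (j : (i : Fin n) → Fin (m i + 1)) (i : Fin n) (s : Fin (m i + 1)) :
    MultidegreeExponent m d :=
  Function.update (baseExponent d j) i
    ⟨Pi.single (j i) (d i - 1) + Pi.single s 1, by
      simp [Finset.mem_piAntidiag, Finset.sum_add_distrib, Nat.sub_add_cancel (hd i)]⟩

theorem neighborExponent_self {n : ℕ} {m d : Fin n → ℕ} (hd : ∀ i, 1 ≤ d i)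
    (j : (i : Fin n) → Fin (m i + 1)) (i : Fin n) :
    neighborExponent hd j i (j i) = baseExponent d j := by
  rw [neighborExponent, Function.update_eq_iff]
  refine ⟨Subtype.ext ?_, fun _ _ => rfl⟩
  change (Pi.single (j i) (d i - 1) + Pi.single (j i) 1 : Fin (m i + 1) → ℕ) =
    Pi.single (j i) (d i)
  rw [← Pi.single_add, Nat.sub_add_cancel (hd i)]

theorem prod_pow_single {k : ℕ} (y : Fin k → ℂ) (s : Fin k) (e : ℕ) :
    ∏ j, y j ^ (Pi.single s e : Fin k → ℕ) j = y s ^ e := by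
  rw [Fintype.prod_eq_single s]
  · simp
  · intro j hj
    simp [Pi.single_eq_of_ne hj]

theorem monomialVector_baseExponent {n : ℕ} {m d : Fin n → ℕ}
    (j : (i : Fin n) → Fin (m i + 1)) (x : (i : Fin n) → Fin (m i + 1) → ℂ) :
    monomialVector m d x (baseExponent d j) = ∏ i, x i (j i) ^ d i :=
  Finset.prod_congr rfl fun i _ => prod_pow_single (x i) (j i) (d i)

theorem monomialVector_neighborExponent {n : ℕ} {m d : Fin n → ℕ} (hd : ∀ i, 1 ≤ d i)
    (j : (i : Fin n) → Fin (m i + 1)) (i : Fin n) (s : Fin (m i + 1))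
    (x : (i : Fin n) → Fin (m i + 1) → ℂ) :
    monomialVector m d x (neighborExponent hd j i s) * x i (j i) =
      monomialVector m d x (baseExponent d j) * x i s := by
  simp only [monomialVector]
  rw [← Finset.mul_prod_erase _ _ (Finset.mem_univ i),
    ← Finset.mul_prod_erase _ _ (Finset.mem_univ i)]
  have h : ∀ i' ∈ Finset.univ.erase i,
      ∏ l, x i' l ^ (neighborExponent hd j i s i' : Fin (m i' + 1) → ℕ) l =
      ∏ l, x i' l ^ (baseExponent d j i' : Fin (m i' + 1) → ℕ) l := by
    intro i' hi'
    rw [neighborExponent, Function.update_of_ne (Finset.ne_of_mem_erase hi')]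
  rw [Finset.prod_congr rfl h]
  simp only [neighborExponent, Function.update_self, baseExponent, Pi.add_apply, pow_add,
    Finset.prod_mul_distrib, prod_pow_single]
  obtain ⟨e, he⟩ := Nat.exists_eq_add_of_le' (hd i)
  rw [he]
  simp only [Nat.add_sub_cancel, pow_succ]
  ring

theorem monomialVector_baseExponent_ne_zero {n : ℕ} {m d : Fin n → ℕ}
    {j : (i : Fin n) → Fin (m i + 1)} {x : (i : Fin n) → Fin (m i + 1) → ℂ}
    (hj : ∀ i, x i (j i) ≠ 0) : monomialVector m d x (baseExponent d j) ≠ 0 := by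
  rw [monomialVector_baseExponent]
  exact Finset.prod_ne_zero_iff.2 fun i _ => pow_ne_zero _ (hj i)

/-- An equation of the Segre–Veronese variety that expresses, where the base monomial does not
vanish, the coordinate `α` through the base monomial and its neighbors. -/
noncomputable def exchangeEquation {n : ℕ} {m d : Fin n → ℕ} (hd : ∀ i, 1 ≤ d i)
    (j : (i : Fin n) → Fin (m i + 1)) (α : MultidegreeExponent m d) :
    MvPolynomial (MultidegreeExponent m d) ℂ :=
  MvPolynomial.X (baseExponent d j) *
      ∏ i, ∏ s, MvPolynomial.X (neighborExponent hd j i s) ^ (α i : Fin (m i + 1) → ℕ) s -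
    MvPolynomial.X (baseExponent d j) ^ (∑ i, ∑ s, (α i : Fin (m i + 1) → ℕ) s) *
      MvPolynomial.X α

theorem exchangeEquation_mem {n : ℕ} {m d : Fin n → ℕ} (hd : ∀ i, 1 ≤ d i)
    (j : (i : Fin n) → Fin (m i + 1)) (α : MultidegreeExponent m d) :
    exchangeEquation hd j α ∈ homogeneousVanishingIdeal (segreVeronese m d) := by
  intro v hv
  obtain ⟨x, c, -, -, rfl⟩ := exists_of_mem_affineCone hv
  rw [MvPolynomial.aeval_eq_eval]
  have h1 : ∏ i, x i (j i) ^ d i =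
      ∏ i, ∏ s, x i (j i) ^ (α i : Fin (m i + 1) → ℕ) s := by
    refine Finset.prod_congr rfl fun i _ => ?_
    rw [Finset.prod_pow_eq_pow_sum, (Finset.mem_piAntidiag.1 (α i).2).1]
  have h2 : monomialVector m d x (baseExponent d j) *
      ∏ i, ∏ s, monomialVector m d x (neighborExponent hd j i s) ^ (α i : Fin (m i + 1) → ℕ) s =
      monomialVector m d x (baseExponent d j) ^ (∑ i, ∑ s, (α i : Fin (m i + 1) → ℕ) s) *
        monomialVector m d x α := by
    conv_lhs => rw [monomialVector_baseExponent, h1]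
    conv_rhs => rw [show monomialVector m d x α =
      ∏ i, ∏ s, x i s ^ (α i : Fin (m i + 1) → ℕ) s from rfl]
    simp only [← Finset.prod_pow_eq_pow_sum, ← Finset.prod_mul_distrib, ← mul_pow]
    refine Finset.prod_congr rfl fun i _ => Finset.prod_congr rfl fun s _ => ?_
    rw [mul_comm, monomialVector_neighborExponent]
  simp only [exchangeEquation, map_sub, map_mul, map_prod, map_pow, MvPolynomial.eval_X,
    Pi.smul_apply, smul_eq_mul, mul_pow, Finset.prod_mul_distrib]
  simp only [Finset.prod_pow_eq_pow_sum]
  linear_combination c * c ^ (∑ i, ∑ s, (α i : Fin (m i + 1) → ℕ) s) * h2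

/-- The derivative of a polynomial at `v` in the direction `w`. -/
noncomputable def dirDeriv {ι : Type} [Fintype ι] (v w : ι → ℂ) (f : MvPolynomial ι ℂ) : ℂ :=
  ∑ i, MvPolynomial.eval v (MvPolynomial.pderiv i f) * w i

theorem dirDeriv_sub {ι : Type} [Fintype ι] (v w : ι → ℂ) (f g : MvPolynomial ι ℂ) :
    dirDeriv v w (f - g) = dirDeriv v w f - dirDeriv v w g := by
  simp [dirDeriv, sub_mul, Finset.sum_sub_distrib]

theorem dirDeriv_mul {ι : Type} [Fintype ι] (v w : ι → ℂ) (f g : MvPolynomial ι ℂ) :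
    dirDeriv v w (f * g) =
      MvPolynomial.eval v f * dirDeriv v w g + MvPolynomial.eval v g * dirDeriv v w f := by
  simp only [dirDeriv, Derivation.leibniz, smul_eq_mul, map_add, map_mul, add_mul,
    Finset.sum_add_distrib, Finset.mul_sum, mul_assoc]

theorem dirDeriv_X {ι : Type} [Fintype ι] (v w : ι → ℂ) (i : ι) :
    dirDeriv v w (MvPolynomial.X i) = w i := by
  classical
  simp [dirDeriv, MvPolynomial.pderiv_X, Pi.single_apply]

/-- The polynomials whose derivative in a given direction vanishes, as a multiplicative monoid. -/
noncomputable def constantAlong {ι : Type} [Fintype ι] (v w : ι → ℂ) :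
    Submonoid (MvPolynomial ι ℂ) where
  carrier := {f | dirDeriv v w f = 0}
  one_mem' := by simp [dirDeriv]
  mul_mem' := by
    intro f g hf hg
    change dirDeriv v w (f * g) = 0
    change dirDeriv v w f = 0 at hf
    change dirDeriv v w g = 0 at hg
    rw [dirDeriv_mul, hf, hg, mul_zero, mul_zero, add_zero]

/-- A tangent vector is determined by its coordinates at the base monomial and its neighbors. -/
theorem tangent_eq_zero {n : ℕ} {m d : Fin n → ℕ} (hd : ∀ i, 1 ≤ d i)
    {j : (i : Fin n) → Fin (m i + 1)} {v w : MultidegreeExponent m d → ℂ}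
    (hv : v (baseExponent d j) ≠ 0) (hw : w ∈ coneTangentSpace (segreVeronese m d) v)
    (h0 : w (baseExponent d j) = 0) (h1 : ∀ i s, w (neighborExponent hd j i s) = 0) :
    w = 0 := by
  funext α
  have h : dirDeriv v w (exchangeEquation hd j α) = 0 := hw _ (exchangeEquation_mem hd j α)
  have hb : MvPolynomial.X (baseExponent d j) ∈ constantAlong v w := by
    change dirDeriv v w _ = 0
    rw [dirDeriv_X, h0]
  have hn : ∀ i s, MvPolynomial.X (neighborExponent hd j i s) ∈ constantAlong v w := by
    intro i s
    change dirDeriv v w _ = 0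
    rw [dirDeriv_X, h1]
  have h2 : dirDeriv v w (MvPolynomial.X (baseExponent d j) *
      ∏ i, ∏ s, MvPolynomial.X (neighborExponent hd j i s) ^ (α i : Fin (m i + 1) → ℕ) s) = 0 :=
    mul_mem hb (prod_mem fun i _ => prod_mem fun s _ => pow_mem (hn i s) _)
  have h3 : dirDeriv v w (MvPolynomial.X (baseExponent d j) ^
      (∑ i, ∑ s, (α i : Fin (m i + 1) → ℕ) s)) = 0 := pow_mem hb _
  rw [exchangeEquation, dirDeriv_sub, h2, dirDeriv_mul, h3, dirDeriv_X, mul_zero, add_zero,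
    zero_sub, neg_eq_zero, map_pow, MvPolynomial.eval_X] at h
  exact (mul_eq_zero.1 h).resolve_left (pow_ne_zero _ hv)

/-- The coordinates at the base monomial and its neighbors of a tangent vector of the
parametrization can be prescribed, subject to the obvious compatibility. -/
theorem exists_fderiv_coneParam {n : ℕ} {m d : Fin n → ℕ} (hd : ∀ i, 1 ≤ d i)
    {j : (i : Fin n) → Fin (m i + 1)} {x : (i : Fin n) → Fin (m i + 1) → ℂ}
    (hj : ∀ i, x i (j i) ≠ 0) {c : ℂ} (hc : c ≠ 0) (b₀ : ℂ)
    (b : (i : Fin n) → Fin (m i + 1) → ℂ) (hb : ∀ i, b i (j i) = b₀) :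
    ∃ q, fderiv ℂ (coneParam m d) (c, x) q (baseExponent d j) = b₀ ∧
      ∀ i s, fderiv ℂ (coneParam m d) (c, x) q (neighborExponent hd j i s) = b i s := by
  set μ₀ := monomialVector m d x (baseExponent d j) with hμ₀
  have hμ : μ₀ ≠ 0 := monomialVector_baseExponent_ne_zero hj
  let c' := b₀ / μ₀
  -- With this choice the coordinates `y i (j i)` vanish, so that `x + ε y` has the same base
  -- monomial for all `ε`, and the neighbors of the base monomial depend linearly on `ε`.
  let y : (i : Fin n) → Fin (m i + 1) → ℂ := fun i s =>
    (b i s - c' * (μ₀ / x i (j i) * x i s)) * x i (j i) / (c * μ₀)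
  have hy : ∀ i, y i (j i) = 0 := by
    intro i
    have h1 := hj i
    simp only [y, c', hb]
    field_simp
    ring
  let γ : ℂ → ℂ × ((i : Fin n) → Fin (m i + 1) → ℂ) := fun ε => (c, x) + ε • (c', y)
  have hγ : HasDerivAt γ (c', y) 0 := by
    have h := ((hasDerivAt_id (0 : ℂ)).smul_const ((c', y) :
      ℂ × ((i : Fin n) → Fin (m i + 1) → ℂ))).const_add (c, x)
    rw [one_smul] at h
    exact h
  have hγ0 : γ 0 = (c, x) := by simp [γ]
  have hd0 : HasDerivAt (coneParam m d ∘ γ) (fderiv ℂ (coneParam m d) (c, x) (c', y)) 0 := by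
    have h := (hasStrictFDerivAt_coneParam m d (γ 0)).hasFDerivAt.comp_hasDerivAt 0 hγ
    rwa [hγ0] at h
  rw [hasDerivAt_pi] at hd0
  have hbase : ∀ ε : ℂ, monomialVector m d (x + ε • y) (baseExponent d j) = μ₀ := by
    intro ε
    rw [hμ₀, monomialVector_baseExponent, monomialVector_baseExponent]
    simp [hy]
  refine ⟨(c', y), ?_, fun i s => ?_⟩
  · refine (hd0 (baseExponent d j)).unique ?_
    have h : (fun ε => (coneParam m d ∘ γ) ε (baseExponent d j)) =
        fun ε => (c + ε * c') * μ₀ := by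
      funext ε
      simp [coneParam, γ, hbase]
    rw [h]
    have h2 := (((hasDerivAt_id (0 : ℂ)).mul_const c').const_add c).mul_const μ₀
    refine h2.congr_deriv ?_
    simp only [c']
    field_simp
  · refine (hd0 (neighborExponent hd j i s)).unique ?_
    have h : (fun ε => (coneParam m d ∘ γ) ε (neighborExponent hd j i s)) =
        fun ε => (c + ε * c') * (μ₀ / x i (j i) * (x i s + ε * y i s)) := by
      funext ε
      have h1 := monomialVector_neighborExponent hd j i s (x + ε • y)
      rw [hbase] at h1
      have h3 := hj i
      simp only [Pi.add_apply, Pi.smul_apply, hy, smul_zero, add_zero] at h1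
      have h4 : monomialVector m d (x + ε • y) (neighborExponent hd j i s) =
          μ₀ / x i (j i) * (x i s + ε * y i s) := by
        field_simp
        rw [h1, smul_eq_mul]
      simp [coneParam, γ, h4]
    rw [h]
    have h2 := (((hasDerivAt_id (0 : ℂ)).mul_const c').const_add c).mul
      ((((hasDerivAt_id (0 : ℂ)).mul_const (y i s)).const_add (x i s)).const_mul (μ₀ / x i (j i)))
    refine h2.congr_deriv ?_
    have h3 := hj i
    simp only [y, id, zero_mul, add_zero, one_mul]
    field_simp
    ring

/-- At every nonzero `c • μ(x)` the Zariski tangent space is the image of the derivative of the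
parametrization. -/
theorem exists_fderiv_coneParam_eq {n : ℕ} {m d : Fin n → ℕ} (hd : ∀ i, 1 ≤ d i)
    {x : (i : Fin n) → Fin (m i + 1) → ℂ} (hx : ∀ i, x i ≠ 0) {c : ℂ} (hc : c ≠ 0)
    {w : MultidegreeExponent m d → ℂ}
    (hw : w ∈ coneTangentSpace (segreVeronese m d) (coneParam m d (c, x))) :
    ∃ q, fderiv ℂ (coneParam m d) (c, x) q = w := by
  choose j hj using fun i => Function.ne_iff.1 (hx i)
  obtain ⟨q, h0, h1⟩ := exists_fderiv_coneParam hd hj hc (w (baseExponent d j))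
    (fun i s => w (neighborExponent hd j i s)) (fun i => by rw [neighborExponent_self])
  refine ⟨q, sub_eq_zero.1 (tangent_eq_zero hd (j := j) (v := coneParam m d (c, x)) ?_
    (sub_mem (fderiv_coneParam_mem m d _ q) hw) ?_ ?_)⟩
  · exact mul_ne_zero hc (monomialVector_baseExponent_ne_zero hj)
  · rw [Pi.sub_apply, h0, sub_self]
  · intro i s
    rw [Pi.sub_apply, h1, sub_self]

theorem finrank_coneTangentSpace {n : ℕ} {m d : Fin n → ℕ} (hd : ∀ i, 1 ≤ d i)
    {x : (i : Fin n) → Fin (m i + 1) → ℂ} (hx : ∀ i, x i ≠ 0) {c : ℂ} (hc : c ≠ 0) :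
    Module.finrank ℂ (coneTangentSpace (segreVeronese m d) (coneParam m d (c, x))) =
      ∑ i, m i + 1 := by
  choose j hj using fun i => Function.ne_iff.1 (hx i)
  let T := coneTangentSpace (segreVeronese m d) (coneParam m d (c, x))
  let B : T →ₗ[ℂ] (((i : Fin n) → {s : Fin (m i + 1) // s ≠ j i} → ℂ) × ℂ) :=
    { toFun := fun w => (fun i s => w.1 (neighborExponent hd j i s), w.1 (baseExponent d j))
      map_add' := fun _ _ => rfl
      map_smul' := fun _ _ => rfl }
  have hB : Function.Bijective B := by
    constructor
    · rw [injective_iff_map_eq_zero]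
      intro w hw
      have h0 : w.1 (baseExponent d j) = 0 := congrArg Prod.snd hw
      apply Subtype.ext
      refine tangent_eq_zero hd (j := j) ?_ w.2 h0 fun i s => ?_
      · exact mul_ne_zero hc (monomialVector_baseExponent_ne_zero hj)
      · by_cases hs : s = j i
        · rw [hs, neighborExponent_self, h0]
        · exact congrFun (congrFun (congrArg Prod.fst hw) i) ⟨s, hs⟩
    · rintro ⟨b, b₀⟩
      obtain ⟨q, h0, h1⟩ := exists_fderiv_coneParam hd hj hc b₀
        (fun i s => if h : s = j i then b₀ else b i ⟨s, h⟩) (fun i => by simp)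
      refine ⟨⟨_, fderiv_coneParam_mem m d _ q⟩, Prod.ext ?_ h0⟩
      funext i s
      refine (h1 i s).trans ?_
      rw [dif_neg s.2]
  rw [(LinearEquiv.ofBijective B hB).finrank_eq, Module.finrank_prod, Module.finrank_self,
    Module.finrank_pi_fintype]
  simp [Fintype.card_subtype_compl]

/-! ### Bézout's inequality -/

theorem linear_comp_monomialVector_mem {n : ℕ} (m d : Fin n → ℕ)
    (ℓ : (MultidegreeExponent m d → ℂ) →ₗ[ℂ] ℂ) :
    (fun x => ℓ (monomialVector m d x)) ∈ multiForms m d := by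
  have h : (fun x => ℓ (monomialVector m d x)) =
      ∑ α, ℓ (Pi.single α 1) • fun x => monomialVector m d x α := by
    funext x
    rw [Finset.sum_apply, LinearMap.pi_apply_eq_sum_univ ℓ]
    refine Finset.sum_congr rfl fun α _ => ?_
    rw [Pi.smul_apply, smul_eq_mul, smul_eq_mul, mul_comm]
    congr 2
    funext β
    rw [Pi.single_apply]
    simp only [eq_comm]
  rw [h]
  exact sum_mem fun α _ => Submodule.smul_mem _ _ (Submodule.subset_span ⟨α, rfl⟩)

theorem prod_mem_multiForms {n : ℕ} {m : Fin n → ℕ} {κ : Type*} (s : Finset κ)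
    {f : κ → ((i : Fin n) → Fin (m i + 1) → ℂ) → ℂ} {e : κ → Fin n → ℕ}
    (hf : ∀ t ∈ s, f t ∈ multiForms m (e t)) : ∏ t ∈ s, f t ∈ multiForms m (∑ t ∈ s, e t) := by
  induction s using Finset.cons_induction with
  | empty =>
    rw [Finset.prod_empty, Finset.sum_empty, multiForms_zero]
    exact Submodule.one_le.1 le_rfl
  | cons t s ht ih =>
    rw [Finset.prod_cons, Finset.sum_cons, ← multiForms_mul]
    exact Submodule.mul_mem_mul (hf t (Finset.mem_cons_self t s))
      (ih fun t' ht' => hf t' (Finset.mem_cons_of_mem ht'))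

/-- Monomials remain linearly independent on every nonempty open set. -/
theorem coeff_eq_zero_of_eventually {k e : ℕ}
    (c : ↥(Finset.piAntidiag (Finset.univ : Finset (Fin k)) e) → ℂ) (y₀ : Fin k → ℂ)
    (h : ∀ᶠ y in nhds y₀, ∑ a, c a * ∏ t, y t ^ (a : Fin k → ℕ) t = 0) : c = 0 := by
  classical
  let P : MvPolynomial (Fin k) ℂ :=
    ∑ a : ↥(Finset.piAntidiag (Finset.univ : Finset (Fin k)) e),
      MvPolynomial.monomial (Finsupp.equivFunOnFinite.symm (a : Fin k → ℕ)) (c a)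
  have hP : ∀ y, MvPolynomial.eval y P = ∑ a, c a * ∏ t, y t ^ (a : Fin k → ℕ) t := by
    intro y
    simp [P, MvPolynomial.eval_monomial, Finsupp.prod_fintype]
  obtain ⟨ε, hε, hb⟩ := Metric.eventually_nhds_iff_ball.1 h
  have hP0 : P = 0 := by
    refine MvPolynomial.funext_set (fun t => Metric.ball (y₀ t) ε)
      (fun t => infinite_of_mem_nhds (y₀ t) (Metric.ball_mem_nhds _ hε)) fun y hy => ?_
    rw [hP, map_zero]
    refine hb y ?_
    rw [ball_pi _ hε]
    exact hy
  funext a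
  have h1 := congrArg (MvPolynomial.coeff (Finsupp.equivFunOnFinite.symm (a : Fin k → ℕ))) hP0
  simp only [P, MvPolynomial.coeff_sum, MvPolynomial.coeff_monomial, MvPolynomial.coeff_zero,
    EmbeddingLike.apply_eq_iff_eq, SetLike.coe_eq_coe, Finset.sum_ite_eq', Finset.mem_univ,
    if_true] at h1
  exact h1

/-- Linear forms `f₀` and `F` on the ambient space such that `F` cuts out `W` transversely at the
point represented by `v = c • μ(x)` and `f₀ v ≠ 0` give a submersion on the affine cone. -/
theorem map_nhds_linear_comp_coneParam {n : ℕ} {m d : Fin n → ℕ} (hd : ∀ i, 1 ≤ d i) {k : ℕ}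
    (f₀ : (MultidegreeExponent m d → ℂ) →ₗ[ℂ] ℂ)
    (F : (MultidegreeExponent m d → ℂ) →ₗ[ℂ] (Fin k → ℂ)) (hF : Function.Surjective F)
    {x : (i : Fin n) → Fin (m i + 1) → ℂ} (hx : ∀ i, x i ≠ 0) {c : ℂ} (hc : c ≠ 0)
    (hW : coneTangentSpace (segreVeronese m d) (coneParam m d (c, x)) ⊔ LinearMap.ker F = ⊤)
    (hFv : F (coneParam m d (c, x)) = 0) (hf₀ : f₀ (coneParam m d (c, x)) ≠ 0) :
    Filter.map (fun p => (Fin.cons (f₀ (coneParam m d p)) (F (coneParam m d p)) : Fin (k + 1) → ℂ))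
      (nhds (c, x)) =
      nhds (Fin.cons (f₀ (coneParam m d (c, x))) (F (coneParam m d (c, x)))) := by
  let G : (MultidegreeExponent m d → ℂ) →ₗ[ℂ] (Fin (k + 1) → ℂ) :=
    LinearMap.pi (Fin.cons f₀ fun t => (LinearMap.proj t).comp F)
  have hG : ∀ v, G v = Fin.cons (f₀ v) (F v) := by
    intro v
    funext t
    refine Fin.cases ?_ (fun t => ?_) t <;> simp [G]
  have hstrict := G.toContinuousLinearMap.hasStrictFDerivAt.comp (c, x)
    (hasStrictFDerivAt_coneParam m d (c, x))
  have hfun : (fun p => G.toContinuousLinearMap (coneParam m d p)) =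
      fun p => (Fin.cons (f₀ (coneParam m d p)) (F (coneParam m d p)) : Fin (k + 1) → ℂ) := by
    funext p
    exact hG _
  rw [hfun] at hstrict
  refine hstrict.map_nhds_eq_of_surj ?_
  rw [LinearMap.range_eq_top]
  intro b
  -- `F` maps the tangent space onto the whole space; the value of `f₀` is then adjusted by a
  -- multiple of the vector `v` itself, which is tangent and killed by `F`.
  obtain ⟨u, hu⟩ := hF (Fin.tail b)
  have hu' : u ∈ coneTangentSpace (segreVeronese m d) (coneParam m d (c, x)) ⊔ LinearMap.ker F := by
    rw [hW]
    trivial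
  obtain ⟨w, hw, z, hz, rfl⟩ := Submodule.mem_sup.1 hu'
  rw [map_add, LinearMap.mem_ker.1 hz, add_zero] at hu
  obtain ⟨q, rfl⟩ := exists_fderiv_coneParam_eq hd hx hc hw
  have hv : coneParam m d (c, x) ∈
      coneTangentSpace (segreVeronese m d) (coneParam m d (c, x)) := by
    have h1 : HasDerivAt (fun ε : ℂ => coneParam m d ((c, x) + ε • (c, 0)))
        (coneParam m d (c, x)) 0 := by
      have h2 : (fun ε : ℂ => coneParam m d ((c, x) + ε • (c, 0))) =
          fun ε : ℂ => (1 + ε) • coneParam m d (c, x) := by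
        funext ε
        simp only [coneParam, Prod.smul_mk, smul_eq_mul, smul_zero, Prod.mk_add_mk, add_zero,
          smul_smul]
        congr 1
        ring
      rw [h2]
      exact (((hasDerivAt_id (0 : ℂ)).const_add 1).smul_const (coneParam m d (c, x))).congr_deriv
        (one_smul _ _)
    have h3 : HasDerivAt (fun ε : ℂ => (c, x) + ε • ((c, 0) :
        ℂ × ((i : Fin n) → Fin (m i + 1) → ℂ))) (c, 0) 0 := by
      have h := ((hasDerivAt_id (0 : ℂ)).smul_const ((c, 0) :
        ℂ × ((i : Fin n) → Fin (m i + 1) → ℂ))).const_add (c, x)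
      rw [one_smul] at h
      exact h
    have h4 := (hasStrictFDerivAt_coneParam m d ((c, x) + (0 : ℂ) •
      ((c, 0) : ℂ × ((i : Fin n) → Fin (m i + 1) → ℂ)))).hasFDerivAt.comp_hasDerivAt 0 h3
    rw [zero_smul, add_zero] at h4
    have h5 := fderiv_coneParam_mem m d (c, x) (c, 0)
    rwa [← h1.unique h4] at h5
  obtain ⟨q', hq'⟩ := exists_fderiv_coneParam_eq hd hx hc hv
  let s := (b 0 - f₀ (fderiv ℂ (coneParam m d) (c, x) q)) / f₀ (coneParam m d (c, x))
  refine ⟨q + s • q', ?_⟩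
  change G (fderiv ℂ (coneParam m d) (c, x) (q + s • q')) = b
  rw [map_add, map_smul, hq', hG, map_add, map_smul, map_add, map_smul, hFv, hu, smul_zero,
    add_zero, smul_eq_mul, div_mul_cancel₀ _ hf₀, add_sub_cancel]
  exact Fin.cons_self_tail b

/-- The dimension estimate behind Bézout's inequality: the products of forms of degree `K` in
`f₀, f₁, …, f_M`, where `f₁, …, f_M` cut out `W` and `f₀` vanishes at none of the `r` given points
of `X ∩ W`, with the powers `h^b`, `b < r`, of a linear form `h` that separates these points, are
linearly independent on `X`. -/
theorem mul_choose_le_of_intersectsTransversely {n : ℕ} {m d : Fin n → ℕ} (hd : ∀ i, 1 ≤ d i)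
    {W : Submodule ℂ (MultidegreeExponent m d → ℂ)}
    (hdim : Module.finrank ℂ W + ∑ i, m i = Fintype.card (MultidegreeExponent m d))
    (hW : IntersectsTransversely (segreVeronese m d) W) {r : ℕ}
    (x : Fin r → (i : Fin n) → Fin (m i + 1) → ℂ) (hx : ∀ s i, x s i ≠ 0)
    (hxW : ∀ s, monomialVector m d (x s) ∈ W)
    (hsep : ∀ s s', s ≠ s' → ∀ c : ℂ, monomialVector m d (x s) ≠ c • monomialVector m d (x s'))
    (K : ℕ) :
    r * (∑ i, m i + K).choose (∑ i, m i) ≤ ∏ i, (m i + (K + r) * d i).choose (m i) := by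
  classical
  set M := ∑ i, m i with hM
  have hquot : Module.finrank ℂ ((MultidegreeExponent m d → ℂ) ⧸ W) =
      Module.finrank ℂ (Fin M → ℂ) := by
    have := W.finrank_quotient_add_finrank
    rw [Module.finrank_fintype_fun_eq_card] at this
    rw [Module.finrank_fin_fun]
    omega
  let e := LinearEquiv.ofFinrankEq _ _ hquot
  let F : (MultidegreeExponent m d → ℂ) →ₗ[ℂ] (Fin M → ℂ) := e.toLinearMap.comp W.mkQ
  have hFker : LinearMap.ker F = W := by
    rw [LinearEquiv.ker_comp, Submodule.ker_mkQ]
  have hFsurj : Function.Surjective F := e.surjective.comp W.mkQ_surjective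
  obtain ⟨f₀, hf₀⟩ := Module.exists_dual_forall_apply_ne_zero (K := ℂ)
    (fun s => monomialVector m d (x s)) fun s => monomialVector_ne_zero m d (x s) (hx s)
  let c : Fin r → ℂ := fun s => (f₀ (monomialVector m d (x s)))⁻¹
  have hc : ∀ s, c s ≠ 0 := fun s => inv_ne_zero (hf₀ s)
  let v : Fin r → MultidegreeExponent m d → ℂ := fun s => coneParam m d (c s, x s)
  have hv : ∀ s, v s = c s • monomialVector m d (x s) := fun s => rfl
  have hvf : ∀ s, f₀ (v s) = 1 := by
    intro s
    rw [hv, map_smul, smul_eq_mul]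
    exact inv_mul_cancel₀ (hf₀ s)
  have hvF : ∀ s, F (v s) = 0 := by
    intro s
    rw [← LinearMap.mem_ker, hFker]
    exact W.smul_mem _ (hxW s)
  obtain ⟨h, hh⟩ := Module.exists_dual_forall_apply_ne_zero (K := ℂ)
    (fun p : {p : Fin r × Fin r // p.1 ≠ p.2} => v p.1.1 - v p.1.2) (by
      rintro ⟨⟨s, s'⟩, hs⟩ h0
      rw [sub_eq_zero] at h0
      refine hsep s s' hs ((c s)⁻¹ * c s') ?_
      rw [mul_smul]
      change _ = _ • v s'
      rw [← h0, hv, inv_smul_smul₀ (hc s)])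
  have hinj : Function.Injective fun s => h (v s) := by
    intro s s' hs
    by_contra hne
    refine hh ⟨(s, s'), hne⟩ ?_
    rw [map_sub, sub_eq_zero]
    exact hs
  obtain ⟨U, hU, hUd⟩ := (Set.finite_range fun s => h (v s)).t2_separation
  -- Near the base value each of the `r` points has a local preimage, on which `h` takes
  -- pairwise different values.
  have hlocal : ∀ᶠ y in nhds (Fin.cons 1 0 : Fin (M + 1) → ℂ), ∀ s, ∃ p,
      (Fin.cons (f₀ (coneParam m d p)) (F (coneParam m d p)) : Fin (M + 1) → ℂ) = y ∧
        h (coneParam m d p) ∈ U (h (v s)) := by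
    rw [Filter.eventually_all]
    intro s
    have hmem := hW (v s) (monomialVector_mem_affineCone m d (x s) (hx s) (c s) (hc s))
      (W.smul_mem _ (hxW s))
    have h1 := map_nhds_linear_comp_coneParam hd f₀ F hFsurj (hx s) (hc s)
      (by rw [hFker]; exact hmem.2) (hvF s) (by change f₀ (v s) ≠ 0; rw [hvf]; exact one_ne_zero)
    change _ = nhds (Fin.cons (f₀ (v s)) (F (v s)) : Fin (M + 1) → ℂ) at h1
    rw [hvf, hvF] at h1
    rw [← h1]
    have hcont : Continuous fun p => h (coneParam m d p) :=
      h.toContinuousLinearMap.continuous.comp (contDiff_coneParam m d).continuous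
    have hnear : ∀ᶠ p in nhds (c s, x s), h (coneParam m d p) ∈ U (h (v s)) :=
      hcont.continuousAt.eventually_mem ((hU _).2.mem_nhds (hU _).1)
    rw [Filter.eventually_map]
    exact hnear.mono fun p hp => ⟨p, rfl, hp⟩
  let Gx : Fin (M + 1) → ((i : Fin n) → Fin (m i + 1) → ℂ) → ℂ := fun t x =>
    (Fin.cons (f₀ (monomialVector m d x)) (F (monomialVector m d x)) : Fin (M + 1) → ℂ) t
  have hGx : ∀ t, Gx t ∈ multiForms m d := by
    intro t
    refine Fin.cases ?_ (fun t => ?_) t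
    · exact linear_comp_monomialVector_mem m d f₀
    · exact linear_comp_monomialVector_mem m d ((LinearMap.proj t).comp F)
  let A := ↥(Finset.piAntidiag (Finset.univ : Finset (Fin (M + 1))) K)
  let g : Fin r × A → (((i : Fin n) → Fin (m i + 1) → ℂ) → ℂ) := fun p =>
    (∏ t, Gx t ^ (p.2 : Fin (M + 1) → ℕ) t) *
      ((fun x => f₀ (monomialVector m d x)) ^ (r - (p.1 : ℕ)) *
        (fun x => h (monomialVector m d x)) ^ (p.1 : ℕ))
  have hg : ∀ p, g p ∈ multiForms m ((K + r) • d) := by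
    intro p
    have h1 := prod_mem_multiForms Finset.univ fun t _ =>
      multiForms_pow m d ((p.2 : Fin (M + 1) → ℕ) t) ▸ Submodule.pow_mem_pow _ (hGx t) _
    rw [← Finset.sum_smul, (Finset.mem_piAntidiag.1 p.2.2).1, ← multiForms_pow] at h1
    rw [← multiForms_pow, pow_add]
    refine Submodule.mul_mem_mul h1 ?_
    have h2 : multiForms m d ^ r = multiForms m d ^ (r - (p.1 : ℕ)) *
        multiForms m d ^ (p.1 : ℕ) := by
      rw [← pow_add, Nat.sub_add_cancel p.1.2.le]
    rw [h2]
    exact Submodule.mul_mem_mul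
      (Submodule.pow_mem_pow _ (linear_comp_monomialVector_mem m d f₀) _)
      (Submodule.pow_mem_pow _ (linear_comp_monomialVector_mem m d h) _)
  have hgcone : ∀ (p : Fin r × A) (q : ℂ × ((i : Fin n) → Fin (m i + 1) → ℂ)),
      (∏ t, (Fin.cons (f₀ (coneParam m d q)) (F (coneParam m d q)) : Fin (M + 1) → ℂ) t ^
          (p.2 : Fin (M + 1) → ℕ) t) *
        (f₀ (coneParam m d q) ^ (r - (p.1 : ℕ)) * h (coneParam m d q) ^ (p.1 : ℕ)) =
      q.1 ^ (K + r) * g p q.2 := by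
    intro p q
    have h1 : ∀ t, (Fin.cons (f₀ (coneParam m d q)) (F (coneParam m d q)) : Fin (M + 1) → ℂ) t =
        q.1 * Gx t q.2 := by
      intro t
      refine Fin.cases ?_ (fun t => ?_) t <;> simp [Gx, coneParam]
    have h2 : K + r = K + ((r - (p.1 : ℕ)) + p.1) := by omega
    simp only [h1, mul_pow, Finset.prod_mul_distrib, Finset.prod_pow_eq_pow_sum,
      (Finset.mem_piAntidiag.1 p.2.2).1]
    simp only [g, Pi.mul_apply, Finset.prod_apply, Pi.pow_apply]
    rw [h2, pow_add, pow_add]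
    simp only [coneParam, map_smul, smul_eq_mul, mul_pow]
    ring
  have hind : LinearIndependent ℂ g := by
    rw [Fintype.linearIndependent_iff]
    intro a ha
    have hzero : ∀ᶠ y in nhds (Fin.cons 1 0 : Fin (M + 1) → ℂ), ∀ b : Fin r,
        ∑ z : A, a (b, z) * ∏ t, y t ^ (z : Fin (M + 1) → ℕ) t = 0 := by
      have hne : ∀ᶠ y in nhds (Fin.cons 1 0 : Fin (M + 1) → ℂ), y 0 ≠ 0 :=
        (continuous_apply (0 : Fin (M + 1))).continuousAt.eventually_ne (by simp)
      filter_upwards [hlocal, hne] with y hy hy0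
      choose p hp hpU using hy
      have hτ : Function.Injective fun s => h (coneParam m d (p s)) := by
        intro s s' hs
        by_contra hne'
        have hs' : h (coneParam m d (p s)) = h (coneParam m d (p s')) := hs
        exact Set.disjoint_left.1 (hUd ⟨s, rfl⟩ ⟨s', rfl⟩ fun h' => hne' (hinj h'))
          (hpU s) (by rw [hs']; exact hpU s')
      have hvan := Matrix.eq_zero_of_forall_index_sum_mul_pow_eq_zero hτ
        (v := fun b : Fin r => (∑ z : A, a (b, z) * ∏ t, y t ^ (z : Fin (M + 1) → ℕ) t) *
          y 0 ^ (r - (b : ℕ))) (by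
          intro s
          have h1 : ∑ q : Fin r × A, a q * g q (p s).2 = 0 := by
            have := congrFun ha (p s).2
            simpa using this
          have h2 : ∑ q : Fin r × A, a q *
              ((∏ t, y t ^ (q.2 : Fin (M + 1) → ℕ) t) *
                (y 0 ^ (r - (q.1 : ℕ)) * h (coneParam m d (p s)) ^ (q.1 : ℕ))) = 0 := by
            have h3 : ∀ q : Fin r × A, a q *
              ((∏ t, y t ^ (q.2 : Fin (M + 1) → ℕ) t) *
                (y 0 ^ (r - (q.1 : ℕ)) * h (coneParam m d (p s)) ^ (q.1 : ℕ))) =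
                (p s).1 ^ (K + r) * (a q * g q (p s).2) := by
              intro q
              have h4 := hgcone q (p s)
              rw [hp s] at h4
              have h5 : f₀ (coneParam m d (p s)) = y 0 := congrFun (hp s) 0
              rw [h5] at h4
              rw [h4]
              ring
            rw [Finset.sum_congr rfl fun q _ => h3 q, ← Finset.mul_sum, h1, mul_zero]
          rw [Fintype.sum_prod_type] at h2
          rw [← h2]
          refine Finset.sum_congr rfl fun b _ => ?_
          rw [Finset.sum_mul, Finset.sum_mul]
          refine Finset.sum_congr rfl fun z _ => ?_
          ring)
      intro b
      exact (mul_eq_zero.1 (congrFun hvan b)).resolve_right (pow_ne_zero _ hy0)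
    rintro ⟨b, z⟩
    exact congrFun (coeff_eq_zero_of_eventually (fun z => a (b, z)) _
      (hzero.mono fun y hy => hy b)) z
  let g' : Fin r × A → multiForms m ((K + r) • d) := fun p => ⟨g p, hg p⟩
  have hind' : LinearIndependent ℂ g' :=
    LinearIndependent.of_comp (multiForms m ((K + r) • d)).subtype hind
  have hcard := hind'.fintype_card_le_finrank
  rw [finrank_multiForms, Fintype.card_prod, Fintype.card_fin, Fintype.card_coe,
    card_piAntidiag_univ_fin] at hcard
  simpa using hcard

/-- Comparison of the leading terms of the two sides of the dimension estimate. -/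
theorem le_of_forall_mul_choose_le {n : ℕ} (m d : Fin n → ℕ) (r : ℕ)
    (h : ∀ K, r * (∑ i, m i + K).choose (∑ i, m i) ≤
      ∏ i, (m i + (K + r) * d i).choose (m i)) :
    r ≤ (∑ i, m i).factorial / (∏ i, (m i).factorial) * ∏ i, d i ^ m i := by
  set M := ∑ i, m i with hM
  have key : ∀ K : ℕ, (r : ℝ) / M.factorial ≤
      ∏ i, ((((m i : ℝ) + (r - 1) * d i) * (1 / ((K : ℝ) + 1)) + d i) ^ m i /
        (m i).factorial) := by
    intro K
    have hK : (0 : ℝ) < (K : ℝ) + 1 := by positivity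
    have h1 : ((K : ℝ) + 1) ^ M / M.factorial ≤ ((M + K).choose M : ℝ) := by
      have := Nat.pow_le_choose (α := ℝ) M (M + K)
      rw [show M + K + 1 - M = K + 1 by omega] at this
      exact_mod_cast this
    have h2 : ((∏ i, (m i + (K + r) * d i).choose (m i) : ℕ) : ℝ) ≤
        ∏ i, ((m i + (K + r) * d i : ℝ) ^ m i / (m i).factorial) := by
      push_cast
      refine Finset.prod_le_prod (fun i _ => by positivity) fun i _ => ?_
      have := Nat.choose_le_pow_div (α := ℝ) (m i) (m i + (K + r) * d i)
      exact_mod_cast this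
    have h3 : (r : ℝ) * (((K : ℝ) + 1) ^ M / M.factorial) ≤
        ∏ i, ((m i + (K + r) * d i : ℝ) ^ m i / (m i).factorial) := by
      refine (mul_le_mul_of_nonneg_left h1 (by positivity)).trans (le_trans ?_ h2)
      exact_mod_cast h K
    have h4 : ∏ i, ((m i + (K + r) * d i : ℝ) ^ m i / (m i).factorial) =
        ((K : ℝ) + 1) ^ M *
          ∏ i, ((((m i : ℝ) + (r - 1) * d i) * (1 / ((K : ℝ) + 1)) + d i) ^ m i /
            (m i).factorial) := by
      rw [hM, ← Finset.prod_pow_eq_pow_sum, ← Finset.prod_mul_distrib]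
      refine Finset.prod_congr rfl fun i _ => ?_
      rw [← mul_div_assoc, ← mul_pow]
      congr 2
      field_simp
      ring
    rw [h4] at h3
    refine le_of_mul_le_mul_left ?_ (pow_pos hK M)
    calc ((K : ℝ) + 1) ^ M * (r / M.factorial) = r * (((K : ℝ) + 1) ^ M / M.factorial) := by ring
      _ ≤ _ := h3
  have hlim : Filter.Tendsto (fun K : ℕ =>
      ∏ i, ((((m i : ℝ) + (r - 1) * d i) * (1 / ((K : ℝ) + 1)) + d i) ^ m i /
        (m i).factorial)) Filter.atTop (nhds (∏ i, ((d i : ℝ) ^ m i / (m i).factorial))) := by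
    refine tendsto_finsetProd _ fun i _ => ?_
    refine ((Filter.Tendsto.pow ?_ _).div_const _)
    have := (tendsto_one_div_add_atTop_nhds_zero_nat (𝕜 := ℝ)).const_mul
      ((m i : ℝ) + (r - 1) * d i)
    simpa using this.add_const (d i : ℝ)
  have hle := ge_of_tendsto' hlim key
  have hdvd := Nat.prod_factorial_dvd_factorial_sum Finset.univ m
  have hM0 : (0 : ℝ) < M.factorial := by positivity
  have hP0 : ((∏ i, (m i).factorial : ℕ) : ℝ) ≠ 0 := by
    exact_mod_cast Finset.prod_ne_zero_iff.2 fun i _ => (m i).factorial_ne_zero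
  rw [← Nat.cast_le (α := ℝ), Nat.cast_mul, Nat.cast_div hdvd hP0]
  rw [div_le_iff₀ hM0, Finset.prod_div_distrib] at hle
  push_cast
  refine hle.trans (le_of_eq ?_)
  ring

/-- Bézout's inequality for transverse linear sections. -/
theorem encard_realIntersection_le {n : ℕ} {m d : Fin n → ℕ} (hd : ∀ i, 1 ≤ d i)
    {W : Submodule ℂ (MultidegreeExponent m d → ℂ)}
    (hdim : Module.finrank ℂ W + ∑ i, m i = Fintype.card (MultidegreeExponent m d))
    (hW : IntersectsTransversely (segreVeronese m d) W) :
    (realIntersection (segreVeronese m d) W).encard ≤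
      ((∑ i, m i).factorial / (∏ i, (m i).factorial) * ∏ i, d i ^ m i : ℕ) := by
  set D := (∑ i, m i).factorial / (∏ i, (m i).factorial) * ∏ i, d i ^ m i with hD
  by_contra hlt
  rw [not_le] at hlt
  obtain ⟨t, ht, hcard⟩ := Set.exists_subset_encard_eq (Order.add_one_le_of_lt hlt)
  have htfin : t.Finite := Set.finite_of_encard_eq_coe (k := D + 1) (by rw [hcard]; rfl)
  have hncard : t.ncard = D + 1 := by
    rw [Set.ncard, hcard]
    rfl
  have := htfin.fintype
  let e : Fin (D + 1) ≃ t := (Fintype.equivFinOfCardEq (by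
    rw [← hncard, ← Nat.card_coe_set_eq, Nat.card_eq_fintype_card])).symm
  have hex : ∀ s, ∃ x : (i : Fin n) → Fin (m i + 1) → ℂ, ∃ hx : ∀ i, x i ≠ 0,
      (e s : ℙ ℂ (MultidegreeExponent m d → ℂ)) =
        Projectivization.mk ℂ (monomialVector m d x) (monomialVector_ne_zero m d x hx) :=
    fun s => (ht (e s).2).1
  choose x hx hex using hex
  have h := le_of_forall_mul_choose_le m d (D + 1) fun K =>
    mul_choose_le_of_intersectsTransversely hd hdim hW x hx (fun s => by
      have h1 := (ht (e s).2).2.1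
      rw [hex, Projectivization.submodule_mk, Submodule.span_singleton_le_iff_mem] at h1
      exact h1) (fun s s' hs c hc => hs (e.injective (Subtype.ext (by
        rw [hex, hex, Projectivization.mk_eq_mk_iff']
        exact ⟨c, hc.symm⟩)))) K
  rw [← hD] at h
  omega

/-! ### Sections by products of linear forms -/

/-- The value at `t` of the polynomial with coefficient vector `y`. -/
noncomputable def evalNode {k : ℕ} (y : Fin (k + 1) → ℂ) (t : ℂ) : ℂ :=
  ∑ s, y s * t ^ (s : ℕ)

theorem evalNode_add_smul {k : ℕ} (y z : Fin (k + 1) → ℂ) (ε t : ℂ) :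
    evalNode (y + ε • z) t = evalNode y t + ε * evalNode z t := by
  simp only [evalNode, Pi.add_apply, Pi.smul_apply, smul_eq_mul, add_mul, Finset.sum_add_distrib,
    Finset.mul_sum, mul_assoc]

theorem evalNode_smul {k : ℕ} (e : ℂ) (y : Fin (k + 1) → ℂ) (t : ℂ) :
    evalNode (e • y) t = e * evalNode y t := by
  simp only [evalNode, Pi.smul_apply, smul_eq_mul, Finset.mul_sum, mul_assoc]

theorem conj_evalNode {k : ℕ} (y : Fin (k + 1) → ℂ) (t : ℂ) :
    starRingEnd ℂ (evalNode y t) = evalNode (fun s => starRingEnd ℂ (y s)) (starRingEnd ℂ t) := by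
  simp [evalNode]

theorem card_le_of_evalNode_eq_zero {k : ℕ} {y : Fin (k + 1) → ℂ} (hy : y ≠ 0) {P : Type*}
    {t : P → ℂ} (ht : Function.Injective t) (Z : Finset P) (hZ : ∀ p ∈ Z, evalNode y (t p) = 0) :
    Z.card ≤ k := by
  by_contra hlt
  rw [not_le] at hlt
  obtain ⟨e⟩ := Function.Embedding.nonempty_of_card_le (α := Fin (k + 1)) (β := Z)
    (by simpa using hlt)
  refine hy (Matrix.eq_zero_of_forall_index_sum_mul_pow_eq_zero
    (f := fun a => t (e a)) (fun a b hab => e.injective (Subtype.ext (ht hab))) fun a => ?_)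
  exact hZ _ (e a).2

theorem exists_sum_mul_pow_eq_prod {K : Type*} [Field K] {k : ℕ} (Z : Finset K) (hZ : Z.card ≤ k) :
    ∃ y : Fin (k + 1) → K, ∀ t, ∑ s, y s * t ^ (s : ℕ) = ∏ z ∈ Z, (t - z) := by
  let p : Polynomial K := ∏ z ∈ Z, (Polynomial.X - Polynomial.C z)
  have hp : p.natDegree < k + 1 := by
    rw [Polynomial.natDegree_finsetProd_X_sub_C_eq_card]
    omega
  refine ⟨fun s => p.coeff s, fun t => ?_⟩
  rw [Fin.sum_univ_eq_sum_range (fun s => p.coeff s * t ^ s) (k + 1),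
    ← Polynomial.eval_eq_sum_range' hp]
  simp [p, Polynomial.eval_prod]

theorem ne_zero_of_evalNode_eq_prod {k : ℕ} {y : Fin (k + 1) → ℂ} {Z : Finset ℂ}
    (h : ∀ t, evalNode y t = ∏ z ∈ Z, (t - z)) : y ≠ 0 := by
  rintro rfl
  obtain ⟨t, ht⟩ := Infinite.exists_notMem_finset Z
  have h1 := h t
  rw [eq_comm, show evalNode (0 : Fin (k + 1) → ℂ) t = 0 by simp [evalNode],
    Finset.prod_eq_zero_iff] at h1
  obtain ⟨z, hz, h2⟩ := h1
  rw [sub_eq_zero] at h2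
  exact ht (h2 ▸ hz)

/-- The Segre–Veronese map is injective on projective points. -/
theorem exists_smul_eq_of_monomialVector {n : ℕ} {m d : Fin n → ℕ} (hd : ∀ i, 1 ≤ d i)
    {x x' : (i : Fin n) → Fin (m i + 1) → ℂ} (hx : ∀ i, x i ≠ 0) {c : ℂ}
    (h : monomialVector m d x = c • monomialVector m d x') (i : Fin n) :
    ∃ e : ℂ, e ≠ 0 ∧ x i = e • x' i := by
  choose j hj using fun i => Function.ne_iff.1 (hx i)
  have h0 := monomialVector_baseExponent_ne_zero (d := d) hj
  have hb := congrFun h (baseExponent d j)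
  rw [hb, Pi.smul_apply, smul_eq_mul] at h0
  have hb' := right_ne_zero_of_mul h0
  have hj' : x' i (j i) ≠ 0 := by
    rw [monomialVector_baseExponent, Finset.prod_ne_zero_iff] at hb'
    intro h1
    refine hb' i (Finset.mem_univ i) ?_
    rw [h1, zero_pow (by have := hd i; omega)]
  refine ⟨x i (j i) / x' i (j i), div_ne_zero (hj i) hj', ?_⟩
  funext s
  have h1 := monomialVector_neighborExponent hd j i s x
  have h2 := monomialVector_neighborExponent hd j i s x'
  have hn := congrFun h (neighborExponent hd j i s)
  rw [hn, hb] at h1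
  simp only [Pi.smul_apply, smul_eq_mul] at h1 ⊢
  have h3 : c * monomialVector m d x' (baseExponent d j) * (x i s * x' i (j i)) =
      c * monomialVector m d x' (baseExponent d j) * (x i (j i) * x' i s) := by
    linear_combination (-x' i (j i)) * h1 + c * x i (j i) * h2
  have h4 := mul_left_cancel₀ h0 h3
  field_simp
  exact h4

/-- For every `j` in a set `J` of `m₁ + ⋯ + mₙ` indices and every group `i` of variables, `dᵢ`
complex nodes, such that all the nodes of a group are distinct and complex conjugation permutes
the `J`-indexed families of nodes. A node `t` stands for the linear form `∑ₛ x_{i,s} tˢ`. -/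
structure NodeSystem {n : ℕ} (m d : Fin n → ℕ) (J : Type) [Fintype J] where
  /-- the nodes -/
  node : (i : Fin n) → J × Fin (d i) → ℂ
  injective : ∀ i, Function.Injective (node i)
  card_eq : Fintype.card J = ∑ i, m i
  /-- the index of the family conjugate to a given one -/
  conjIndex : J → J
  conj_node : ∀ i j, ∃ e : Equiv.Perm (Fin (d i)),
    ∀ l, starRingEnd ℂ (node i (j, l)) = node i (conjIndex j, e l)

namespace NodeSystem

variable {n : ℕ} {m d : Fin n → ℕ} {J : Type} [Fintype J]

/-- The product of all the linear forms belonging to the index `j`, a form of multidegree `d`. -/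
noncomputable def form (t : NodeSystem m d J) (j : J) (x : (i : Fin n) → Fin (m i + 1) → ℂ) : ℂ :=
  ∏ i, ∏ l, evalNode (x i) (t.node i (j, l))

theorem evalNode_mem_multiForms (m : Fin n → ℕ) (i : Fin n) (t : ℂ) :
    (fun x : (i : Fin n) → Fin (m i + 1) → ℂ => evalNode (x i) t) ∈
      multiForms m (Pi.single i 1) := by
  have h : (fun x : (i : Fin n) → Fin (m i + 1) → ℂ => evalNode (x i) t) =
      ∑ s : Fin (m i + 1), t ^ (s : ℕ) • fun x => x i s := by
    funext x
    simp [evalNode, mul_comm]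
  rw [h]
  refine sum_mem fun s _ => Submodule.smul_mem _ _ (Submodule.subset_span
    ⟨fun i' => ⟨(Pi.single i (Pi.single s 1) : (i : Fin n) → Fin (m i + 1) → ℕ) i', ?_⟩, ?_⟩)
  · by_cases h : i' = i
    · subst h
      simp [Finset.mem_piAntidiag]
    · simp [Pi.single_eq_of_ne h]
  · funext x
    simp only [monomialVector]
    rw [Fintype.prod_eq_single i]
    · simp only [Pi.single_eq_same, prod_pow_single, pow_one]
    · intro i' h
      simp [Pi.single_eq_of_ne h]

theorem form_mem_multiForms (t : NodeSystem m d J) (j : J) : t.form j ∈ multiForms m d := by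
  have h := prod_mem_multiForms Finset.univ fun i (_ : i ∈ Finset.univ) =>
    prod_mem_multiForms Finset.univ fun l (_ : l ∈ Finset.univ) =>
      evalNode_mem_multiForms m i (t.node i (j, l))
  have hsum : ∑ i : Fin n, ∑ _l : Fin (d i), (Pi.single i 1 : Fin n → ℕ) = d := by
    funext i
    simp [Finset.sum_apply, Pi.single_apply]
  rw [hsum] at h
  convert h using 1
  funext x
  simp [form]

theorem exists_coeff (t : NodeSystem m d J) : ∃ c : J → MultidegreeExponent m d → ℂ,
    ∀ j x, ∑ α, c j α * monomialVector m d x α = t.form j x := by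
  have h : ∀ j, ∃ c : MultidegreeExponent m d → ℂ,
      ∑ α, c α • (fun x => monomialVector m d x α) = t.form j := fun j =>
    (Submodule.mem_span_range_iff_exists_fun ℂ).1 (t.form_mem_multiForms j)
  choose c hc using h
  refine ⟨c, fun j x => ?_⟩
  rw [← hc j]
  simp

/-- The coefficients of the form belonging to the index `j`. -/
noncomputable def coeff (t : NodeSystem m d J) : J → MultidegreeExponent m d → ℂ :=
  t.exists_coeff.choose

theorem sum_coeff_mul (t : NodeSystem m d J) (j : J) (x : (i : Fin n) → Fin (m i + 1) → ℂ) :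
    ∑ α, t.coeff j α * monomialVector m d x α = t.form j x :=
  t.exists_coeff.choose_spec j x

theorem conj_form (t : NodeSystem m d J) (j : J) (x : (i : Fin n) → Fin (m i + 1) → ℂ) :
    starRingEnd ℂ (t.form j fun i s => starRingEnd ℂ (x i s)) = t.form (t.conjIndex j) x := by
  simp only [form, map_prod, conj_evalNode, Complex.conj_conj]
  refine Finset.prod_congr rfl fun i _ => ?_
  obtain ⟨e, he⟩ := t.conj_node i j
  rw [← Equiv.prod_comp e fun l => evalNode (x i) (t.node i (t.conjIndex j, l))]
  exact Finset.prod_congr rfl fun l _ => by rw [he]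

theorem conj_coeff (t : NodeSystem m d J) (j : J) (α : MultidegreeExponent m d) :
    starRingEnd ℂ (t.coeff j α) = t.coeff (t.conjIndex j) α := by
  have h : ∑ β, (starRingEnd ℂ (t.coeff j β) - t.coeff (t.conjIndex j) β) •
      (fun x => monomialVector m d x β) = 0 := by
    funext x
    have h1 := t.sum_coeff_mul (t.conjIndex j) x
    rw [← conj_form, ← sum_coeff_mul] at h1
    have h2 : ∀ β, starRingEnd ℂ (monomialVector m d (fun i s => starRingEnd ℂ (x i s)) β) =
        monomialVector m d x β := by
      intro β
      simp [monomialVector]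
    simp only [map_sum, map_mul, h2] at h1
    simp [sub_mul, Finset.sum_sub_distrib, h1]
  exact sub_eq_zero.1
    (Fintype.linearIndependent_iff.1 (linearIndependent_monomialVector m d) _ h α)

/-- The linear forms on the ambient space that restrict to the forms of the system. -/
noncomputable def linearMap (t : NodeSystem m d J) : (MultidegreeExponent m d → ℂ) →ₗ[ℂ] (J → ℂ) :=
  Matrix.mulVecLin (Matrix.of t.coeff)

theorem linearMap_apply (t : NodeSystem m d J) (v : MultidegreeExponent m d → ℂ) (j : J) :
    t.linearMap v j = ∑ α, t.coeff j α * v α := rfl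

theorem linearMap_coneParam (t : NodeSystem m d J)
    (p : ℂ × ((i : Fin n) → Fin (m i + 1) → ℂ)) (j : J) :
    t.linearMap (coneParam m d p) j = p.1 * t.form j p.2 := by
  rw [coneParam, map_smul, Pi.smul_apply, linearMap_apply, sum_coeff_mul, smul_eq_mul]

theorem isRealLinearSpace_ker (t : NodeSystem m d J) :
    IsRealLinearSpace (LinearMap.ker t.linearMap) := by
  refine ⟨Set.range (fun j α => (t.coeff j α).re) ∪ Set.range (fun j α => (t.coeff j α).im),
    fun v => ⟨fun hv a ha => ?_, fun hv => ?_⟩⟩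
  · have h0 : ∀ j, ∑ α, t.coeff j α * v α = 0 := fun j => congrFun hv j
    have h1 : ∀ j, ∑ α, starRingEnd ℂ (t.coeff j α) * v α = 0 := by
      intro j
      simp only [conj_coeff]
      exact h0 _
    rcases ha with ⟨j, rfl⟩ | ⟨j, rfl⟩
    · have h2 : ∀ α, (((t.coeff j α).re : ℝ) : ℂ) * v α =
          (1 / 2) * (t.coeff j α * v α) + (1 / 2) * (starRingEnd ℂ (t.coeff j α) * v α) := by
        intro α
        rw [Complex.re_eq_add_conj]
        ring
      simp only [h2, Finset.sum_add_distrib, ← Finset.mul_sum, h0, h1, mul_zero, add_zero]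
    · have h2 : ∀ α, (((t.coeff j α).im : ℝ) : ℂ) * v α =
          (1 / (2 * Complex.I)) * (t.coeff j α * v α) -
            (1 / (2 * Complex.I)) * (starRingEnd ℂ (t.coeff j α) * v α) := by
        intro α
        rw [Complex.im_eq_sub_conj]
        ring
      simp only [h2, Finset.sum_sub_distrib, ← Finset.mul_sum, h0, h1, mul_zero, sub_zero]
  · rw [LinearMap.mem_ker]
    funext j
    rw [linearMap_apply]
    have h1 := hv _ (Or.inl ⟨j, rfl⟩)
    have h2 := hv _ (Or.inr ⟨j, rfl⟩)
    have h3 : ∀ α, t.coeff j α * v α =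
        (((t.coeff j α).re : ℝ) : ℂ) * v α + Complex.I * ((((t.coeff j α).im : ℝ) : ℂ) * v α) := by
      intro α
      conv_lhs => rw [← Complex.re_add_im (t.coeff j α)]
      ring
    simp only [h3, Finset.sum_add_distrib, ← Finset.mul_sum, h1, h2, mul_zero, add_zero,
      Pi.zero_apply]

open Classical in
/-- The nodes of group `i` whose linear form vanishes at `x`. -/
noncomputable def zeros (t : NodeSystem m d J) (x : (i : Fin n) → Fin (m i + 1) → ℂ) (i : Fin n) :
    Finset (J × Fin (d i)) :=
  Finset.univ.filter fun p => evalNode (x i) (t.node i p) = 0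

theorem mem_zeros (t : NodeSystem m d J) {x : (i : Fin n) → Fin (m i + 1) → ℂ} {i : Fin n}
    {p : J × Fin (d i)} : p ∈ t.zeros x i ↔ evalNode (x i) (t.node i p) = 0 := by
  simp [zeros]

theorem exists_of_form_eq_zero (t : NodeSystem m d J) {x : (i : Fin n) → Fin (m i + 1) → ℂ} {j : J}
    (h : t.form j x = 0) : ∃ i l, (j, l) ∈ t.zeros x i := by
  simp only [form, Finset.prod_eq_zero_iff, Finset.mem_univ, true_and] at h
  simpa only [mem_zeros] using h

/-- A common zero of all the forms kills exactly `mᵢ` linear forms of group `i`, and exactly one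
linear form of each index: at most `mᵢ` forms of group `i` can vanish, and there are
`m₁ + ⋯ + mₙ` indices. -/
theorem card_zeros_and_unique (t : NodeSystem m d J) {x : (i : Fin n) → Fin (m i + 1) → ℂ}
    (hx : ∀ i, x i ≠ 0) (h : ∀ j, t.form j x = 0) :
    (∀ i, (t.zeros x i).card = m i) ∧
      ∀ (j : J) (a b : Σ i, Fin (d i)), (j, a.2) ∈ t.zeros x a.1 → (j, b.2) ∈ t.zeros x b.1 →
        a = b := by
  classical
  have hle : ∀ i ∈ Finset.univ, (t.zeros x i).card ≤ m i := fun i _ =>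
    card_le_of_evalNode_eq_zero (hx i) (t.injective i) _ fun p hp => t.mem_zeros.1 hp
  let Z : Finset (Σ i, J × Fin (d i)) := Finset.univ.sigma fun i => t.zeros x i
  have hsurj : Set.SurjOn (fun q : Σ i, J × Fin (d i) => q.2.1) Z (Finset.univ : Finset J) := by
    intro j _
    obtain ⟨i, l, hl⟩ := t.exists_of_form_eq_zero (h j)
    exact ⟨⟨i, (j, l)⟩, by simpa [Z] using hl, rfl⟩
  have hZ : Z.card = ∑ i, (t.zeros x i).card := Finset.card_sigma _ _
  have h1 : Fintype.card J ≤ Z.card := Finset.card_le_card_of_surjOn _ hsurj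
  have h2 : ∑ i, (t.zeros x i).card ≤ ∑ i, m i := Finset.sum_le_sum hle
  rw [t.card_eq] at h1
  have h3 : ∑ i, (t.zeros x i).card = ∑ i, m i := by omega
  refine ⟨fun i => (Finset.sum_eq_sum_iff_of_le hle).1 h3 i (Finset.mem_univ i), ?_⟩
  intro j a b ha hb
  have hinj := Finset.injOn_of_surjOn_of_card_le (fun q : Σ i, J × Fin (d i) => q.2.1)
    (fun _ _ => Finset.mem_univ _) hsurj (by rw [Finset.card_univ, t.card_eq, hZ, h3])
  have hmem : ∀ c : Σ i, Fin (d i), (j, c.2) ∈ t.zeros x c.1 →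
      (⟨c.1, (j, c.2)⟩ : Σ i, J × Fin (d i)) ∈ (Z : Set (Σ i, J × Fin (d i))) := by
    intro c hc
    simpa [Z] using hc
  have h4 := hinj (hmem a ha) (hmem b hb) rfl
  have h5 := congrArg (fun q : Σ i, J × Fin (d i) => (⟨q.1, q.2.2⟩ : Σ i, Fin (d i))) h4
  exact h5

/-- Every index has its own tangent direction, in which the forms of all the other indices are
constant: move the group containing the vanishing linear form so that all the other vanishing
linear forms of the group stay zero. -/
theorem exists_tangent (t : NodeSystem m d J) {x : (i : Fin n) → Fin (m i + 1) → ℂ}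
    (hx : ∀ i, x i ≠ 0) (h : ∀ j, t.form j x = 0) {c : ℂ} (hc : c ≠ 0) (j₀ : J) :
    ∃ w ∈ coneTangentSpace (segreVeronese m d) (coneParam m d (c, x)),
      t.linearMap w j₀ ≠ 0 ∧ ∀ j, j ≠ j₀ → t.linearMap w j = 0 := by
  classical
  obtain ⟨hcard, huniq⟩ := t.card_zeros_and_unique hx h
  obtain ⟨i₀, l₀, hl₀⟩ := t.exists_of_form_eq_zero (h j₀)
  obtain ⟨q, hq⟩ := exists_sum_mul_pow_eq_prod (k := m i₀)
    (((t.zeros x i₀).erase (j₀, l₀)).image (t.node i₀))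
    (Finset.card_image_le.trans ((Finset.card_erase_le).trans (hcard i₀).le))
  change ∀ t, evalNode q t = _ at hq
  let y : (i : Fin n) → Fin (m i + 1) → ℂ := Pi.single i₀ q
  have hy0 : y i₀ = q := Pi.single_eq_same _ _
  have hfac : ∀ (ε : ℂ) i p, evalNode ((x + ε • y) i) (t.node i p) =
      evalNode (x i) (t.node i p) + ε * evalNode (y i) (t.node i p) := by
    intro ε i p
    exact evalNode_add_smul _ _ _ _
  have hγ : ∀ j, HasDerivAt (fun ε : ℂ => c * t.form j (x + ε • y))
      (t.linearMap (fderiv ℂ (coneParam m d) (c, x) (0, y)) j) 0 := by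
    intro j
    have h3 : HasDerivAt (fun ε : ℂ => (c, x) + ε • ((0, y) :
        ℂ × ((i : Fin n) → Fin (m i + 1) → ℂ))) (0, y) 0 := by
      have h := ((hasDerivAt_id (0 : ℂ)).smul_const ((0, y) :
        ℂ × ((i : Fin n) → Fin (m i + 1) → ℂ))).const_add (c, x)
      rw [one_smul] at h
      exact h
    have h4 := (hasStrictFDerivAt_coneParam m d ((c, x) + (0 : ℂ) •
      ((0, y) : ℂ × ((i : Fin n) → Fin (m i + 1) → ℂ)))).hasFDerivAt.comp_hasDerivAt 0 h3
    rw [zero_smul, add_zero] at h4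
    have h5 := t.linearMap.toContinuousLinearMap.hasFDerivAt.comp_hasDerivAt 0 h4
    have h6 := hasDerivAt_pi.1 h5 j
    refine h6.congr_of_eventuallyEq (Filter.Eventually.of_forall fun ε => ?_)
    change _ = t.linearMap (coneParam m d _) j
    rw [linearMap_coneParam]
    simp
  refine ⟨_, fderiv_coneParam_mem m d (c, x) (0, y), ?_, fun j hj => ?_⟩
  · let R : ℂ → ℂ := fun ε => ∏ p ∈ Finset.univ.erase (⟨i₀, l₀⟩ : Σ i, Fin (d i)),
      (evalNode (x p.1) (t.node p.1 (j₀, p.2)) + ε * evalNode (y p.1) (t.node p.1 (j₀, p.2)))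
    have hform : ∀ ε : ℂ, c * t.form j₀ (x + ε • y) =
        ε * (c * evalNode q (t.node i₀ (j₀, l₀)) * R ε) := by
      intro ε
      rw [form, Finset.prod_sigma' Finset.univ (fun _ => Finset.univ), Finset.univ_sigma_univ,
        ← Finset.mul_prod_erase _ _ (Finset.mem_univ (⟨i₀, l₀⟩ : Σ i, Fin (d i)))]
      simp only [hfac, R, hy0, t.mem_zeros.1 hl₀]
      ring
    have hR : Differentiable ℂ R := by
      refine Differentiable.fun_finsetProd fun p _ => ?_
      fun_prop
    have h1 := (hasDerivAt_id (0 : ℂ)).mul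
      ((hR.const_mul (c * evalNode q (t.node i₀ (j₀, l₀)))) 0).hasDerivAt
    have h2 := hγ j₀
    simp only [hform] at h2
    rw [h2.unique h1]
    simp only [one_mul, id, zero_mul, add_zero]
    refine mul_ne_zero (mul_ne_zero hc ?_) ?_
    · rw [hq, Finset.prod_ne_zero_iff]
      intro z hz h0
      obtain ⟨p, hp, rfl⟩ := Finset.mem_image.1 hz
      rw [sub_eq_zero] at h0
      exact Finset.ne_of_mem_erase hp (t.injective i₀ h0.symm)
    · rw [Finset.prod_ne_zero_iff]
      intro p hp h0
      rw [zero_mul, add_zero] at h0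
      exact Finset.ne_of_mem_erase hp (huniq j₀ p ⟨i₀, l₀⟩ (t.mem_zeros.2 h0) hl₀)
  · obtain ⟨i, l, hl⟩ := t.exists_of_form_eq_zero (h j)
    have hform : ∀ ε : ℂ, c * t.form j (x + ε • y) = 0 := by
      intro ε
      rw [form, Finset.prod_eq_zero (Finset.mem_univ i), mul_zero]
      rw [Finset.prod_eq_zero (Finset.mem_univ l)]
      rw [hfac, t.mem_zeros.1 hl, zero_add]
      by_cases hi : i = i₀
      · subst hi
        rw [hy0, hq, Finset.prod_eq_zero (i := t.node i (j, l)), mul_zero]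
        · refine Finset.mem_image_of_mem _ (Finset.mem_erase.2 ⟨fun h0 => hj ?_, hl⟩)
          exact congrArg Prod.fst h0
        · rw [sub_self]
      · rw [show y i = 0 from Pi.single_eq_of_ne hi _]
        simp [evalNode]
    have h2 := hγ j
    simp only [hform] at h2
    exact h2.unique (hasDerivAt_const _ _)

/-- The tangent space at a common zero of the forms maps onto `ℂ^J`. -/
theorem map_coneTangentSpace (t : NodeSystem m d J) {x : (i : Fin n) → Fin (m i + 1) → ℂ}
    (hx : ∀ i, x i ≠ 0) (h : ∀ j, t.form j x = 0) {c : ℂ} (hc : c ≠ 0) :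
    (coneTangentSpace (segreVeronese m d) (coneParam m d (c, x))).map t.linearMap = ⊤ := by
  classical
  rw [eq_top_iff]
  intro b _
  rw [pi_eq_sum_univ' b]
  refine sum_mem fun j _ => Submodule.smul_mem _ _ ?_
  obtain ⟨w, hw, h0, h1⟩ := t.exists_tangent hx h hc j
  refine ⟨(t.linearMap w j)⁻¹ • w, Submodule.smul_mem _ _ hw, ?_⟩
  funext j'
  rw [map_smul, Pi.smul_apply, smul_eq_mul]
  by_cases hj : j' = j
  · subst hj
    rw [inv_mul_cancel₀ h0]
    simp
  · rw [h1 j' hj, mul_zero]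
    simp [hj]

theorem intersectsTransversely_ker (hd : ∀ i, 1 ≤ d i) (t : NodeSystem m d J) :
    IntersectsTransversely (segreVeronese m d) (LinearMap.ker t.linearMap) := by
  intro v hv hvW
  obtain ⟨x, c, hx, hc, rfl⟩ := exists_of_mem_affineCone hv
  change coneParam m d (c, x) ∈ _ at hvW
  have h : ∀ j, t.form j x = 0 := by
    intro j
    have h1 := congrFun (LinearMap.mem_ker.1 hvW) j
    rw [linearMap_coneParam] at h1
    exact (mul_eq_zero.1 h1).resolve_left hc
  refine ⟨?_, ?_⟩
  · rw [varietyDim_segreVeronese m d hd]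
    exact finrank_coneTangentSpace hd hx hc
  · rw [eq_top_iff]
    intro u _
    have h2 : t.linearMap u ∈
        (coneTangentSpace (segreVeronese m d) (coneParam m d (c, x))).map t.linearMap := by
      rw [t.map_coneTangentSpace hx h hc]
      trivial
    obtain ⟨w, hw, hwu⟩ := h2
    rw [← add_sub_cancel w u]
    refine Submodule.add_mem_sup hw ?_
    rw [LinearMap.mem_ker, map_sub, hwu, sub_self]

open Classical in
/-- The nodes at which group `i` of a common zero has to vanish, when `σ` prescribes for every
index the vanishing linear form. -/
noncomputable def chosenNodes (σ : J → Σ i, Fin (d i)) (i : Fin n) :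
    Finset (J × Fin (d i)) :=
  Finset.univ.filter fun p => σ p.1 = ⟨i, p.2⟩

theorem card_chosenNodes_le [DecidableEq J] {σ : J → Σ i, Fin (d i)}
    {i : Fin n} (hσ : (Finset.univ.filter fun j => (σ j).1 = i).card = m i) :
    (chosenNodes σ i).card ≤ m i := by
  classical
  rw [← hσ]
  refine Finset.card_le_card_of_injOn Prod.fst ?_ ?_
  · intro p hp
    have h1 : σ p.1 = ⟨i, p.2⟩ := by simpa [chosenNodes] using hp
    simp [h1]
  · intro p hp p' hp' hpp
    have h1 : σ p.1 = ⟨i, p.2⟩ := by simpa [chosenNodes] using hp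
    have h2 : σ p'.1 = ⟨i, p'.2⟩ := by simpa [chosenNodes] using hp'
    rw [hpp, h2] at h1
    exact Prod.ext hpp (eq_of_heq (Sigma.mk.inj h1).2).symm

theorem form_eq_zero_of_chosenNodes (t : NodeSystem m d J) {σ : J → Σ i, Fin (d i)}
    {x : (i : Fin n) → Fin (m i + 1) → ℂ}
    (h : ∀ i, ∀ p ∈ chosenNodes σ i, evalNode (x i) (t.node i p) = 0) (j : J) :
    (j, (σ j).2) ∈ t.zeros x (σ j).1 ∧ t.form j x = 0 := by
  have h1 : evalNode (x (σ j).1) (t.node (σ j).1 (j, (σ j).2)) = 0 :=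
    h (σ j).1 (j, (σ j).2) (by simp [chosenNodes])
  refine ⟨t.mem_zeros.2 h1, ?_⟩
  rw [form, Finset.prod_eq_zero (Finset.mem_univ (σ j).1)]
  exact Finset.prod_eq_zero (Finset.mem_univ (σ j).2) h1

theorem exists_zero [DecidableEq J] (t : NodeSystem m d J) {σ : J → Σ i, Fin (d i)}
    (hσ : ∀ i, (Finset.univ.filter fun j => (σ j).1 = i).card = m i) :
    ∃ x : (i : Fin n) → Fin (m i + 1) → ℂ, (∀ i, x i ≠ 0) ∧
      ∀ j, (j, (σ j).2) ∈ t.zeros x (σ j).1 ∧ t.form j x = 0 := by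
  classical
  choose x hx using fun i => exists_sum_mul_pow_eq_prod (k := m i)
    ((chosenNodes σ i).image (t.node i))
    (Finset.card_image_le.trans (card_chosenNodes_le (hσ i)))
  refine ⟨x, fun i => ne_zero_of_evalNode_eq_prod (hx i),
    t.form_eq_zero_of_chosenNodes fun i p hp => ?_⟩
  exact (hx i _).trans (Finset.prod_eq_zero (Finset.mem_image_of_mem _ hp) (sub_self _))

/-- When the nodes are real, the common zeros are represented by real vectors. -/
theorem exists_real_zero [DecidableEq J] (t : NodeSystem m d J) {σ : J → Σ i, Fin (d i)}
    (hσ : ∀ i, (Finset.univ.filter fun j => (σ j).1 = i).card = m i)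
    (u : (i : Fin n) → J × Fin (d i) → ℝ) (hu : ∀ i p, t.node i p = (u i p : ℂ)) :
    ∃ y : (i : Fin n) → Fin (m i + 1) → ℝ, (∀ i, (fun s => (y i s : ℂ)) ≠ 0) ∧
      ∀ j, (j, (σ j).2) ∈ t.zeros (fun i s => (y i s : ℂ)) (σ j).1 ∧
        t.form j (fun i s => (y i s : ℂ)) = 0 := by
  classical
  choose y hy using fun i => exists_sum_mul_pow_eq_prod (k := m i)
    ((chosenNodes σ i).image (u i))
    (Finset.card_image_le.trans (card_chosenNodes_le (hσ i)))
  refine ⟨y, fun i h0 => ?_, t.form_eq_zero_of_chosenNodes fun i p hp => ?_⟩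
  · obtain ⟨r, hr⟩ := Infinite.exists_notMem_finset ((chosenNodes σ i).image (u i))
    have h1 := hy i r
    have h2 : ∀ s, y i s = 0 := fun s => by
      have := congrFun h0 s
      simpa using this
    simp only [h2, zero_mul, Finset.sum_const_zero] at h1
    obtain ⟨z, hz, h3⟩ := Finset.prod_eq_zero_iff.1 h1.symm
    exact hr ((sub_eq_zero.1 h3) ▸ hz)
  · have h1 := (hy i (u i p)).trans
      (Finset.prod_eq_zero (Finset.mem_image_of_mem _ hp) (sub_self _))
    rw [hu, evalNode]
    exact_mod_cast h1

theorem exists_assignment [DecidableEq J] (hd : ∀ i, 1 ≤ d i) (t : NodeSystem m d J) :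
    ∃ σ : J → Σ i, Fin (d i), ∀ i, (Finset.univ.filter fun j => (σ j).1 = i).card = m i := by
  have hcard : Fintype.card J = Fintype.card (Σ i, Fin (m i)) := by
    rw [t.card_eq]
    simp
  let e := Fintype.equivOfCardEq hcard
  refine ⟨fun j => ⟨(e j).1, ⟨0, hd _⟩⟩, fun i => ?_⟩
  rw [← Fintype.card_subtype]
  have e1 : {j // (e j).1 = i} ≃ Fin (m i) :=
    (e.subtypeEquiv fun _ => Iff.rfl).trans (Equiv.sigmaSubtype i)
  rw [Fintype.card_congr e1, Fintype.card_fin]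

theorem finrank_ker (hd : ∀ i, 1 ≤ d i) (t : NodeSystem m d J) :
    Module.finrank ℂ (LinearMap.ker t.linearMap) + varietyDim (segreVeronese m d) =
      Fintype.card (MultidegreeExponent m d) := by
  classical
  obtain ⟨σ, hσ⟩ := t.exists_assignment hd
  obtain ⟨x, hx, h⟩ := t.exists_zero hσ
  have h1 := t.map_coneTangentSpace hx (fun j => (h j).2) one_ne_zero
  have h2 : LinearMap.range t.linearMap = ⊤ := by
    rw [eq_top_iff, ← h1]
    exact LinearMap.map_le_range
  have h3 := t.linearMap.finrank_range_add_finrank_ker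
  rw [h2, finrank_top, Module.finrank_fintype_fun_eq_card, Module.finrank_fintype_fun_eq_card,
    t.card_eq] at h3
  rw [varietyDim_segreVeronese m d hd]
  omega

/-- The number of real points on the linear section given by a system of nodes is a possible
count. -/
theorem mem_possibleRealCounts (hd : ∀ i, 1 ≤ d i) (t : NodeSystem m d J) {k : ℕ}
    (hk : (realIntersection (segreVeronese m d) (LinearMap.ker t.linearMap)).encard = k) :
    k ∈ possibleRealCounts (segreVeronese m d) :=
  ⟨_, t.isRealLinearSpace_ker, t.finrank_ker hd, t.intersectsTransversely_ker hd, hk⟩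

/-- At a real point of the section the vanishing linear forms are closed under conjugation. -/
theorem exists_of_mem_realIntersection (hd : ∀ i, 1 ≤ d i) (t : NodeSystem m d J)
    {p : ℙ ℂ (MultidegreeExponent m d → ℂ)}
    (hp : p ∈ realIntersection (segreVeronese m d) (LinearMap.ker t.linearMap)) :
    ∃ x : (i : Fin n) → Fin (m i + 1) → ℂ, (∀ i, x i ≠ 0) ∧ (∀ j, t.form j x = 0) ∧
      ∀ i a b, t.node i b = starRingEnd ℂ (t.node i a) → a ∈ t.zeros x i → b ∈ t.zeros x i := by
  obtain ⟨⟨x, hx, rfl⟩, hW, u, hu, hpu⟩ := hp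
  refine ⟨x, hx, fun j => ?_, fun i a b hab ha => ?_⟩
  · rw [Projectivization.submodule_mk, Submodule.span_singleton_le_iff_mem, LinearMap.mem_ker] at hW
    have h1 := congrFun hW j
    rwa [linearMap_apply, sum_coeff_mul] at h1
  · rw [Projectivization.mk_eq_mk_iff'] at hpu
    obtain ⟨c, hc⟩ := hpu
    have hconj : monomialVector m d (fun i s => starRingEnd ℂ (x i s)) =
        (fun α => starRingEnd ℂ c * (u α : ℂ)) := by
      funext α
      have h1 := congrArg (starRingEnd ℂ) (congrFun hc α)
      simp only [Pi.smul_apply, smul_eq_mul, map_mul, Complex.conj_ofReal] at h1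
      rw [h1]
      simp [monomialVector]
    have hc0 : c ≠ 0 := by
      rintro rfl
      rw [zero_smul] at hc
      exact monomialVector_ne_zero m d x hx hc.symm
    have h2 : monomialVector m d x = (c * (starRingEnd ℂ c)⁻¹) •
        monomialVector m d (fun i s => starRingEnd ℂ (x i s)) := by
      rw [hconj, ← hc]
      funext α
      have : starRingEnd ℂ c ≠ 0 := by simpa using hc0
      simp only [Pi.smul_apply, smul_eq_mul]
      field_simp
    obtain ⟨e, he, hxe⟩ := exists_smul_eq_of_monomialVector hd hx h2 i
    rw [mem_zeros] at ha ⊢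
    rw [hab, hxe, evalNode_smul, ← conj_evalNode, ha, map_zero, mul_zero]

end NodeSystem

/-! ### The possible numbers of real points -/

open MvPolynomial in
/-- The number of ways of choosing for each of the `m₁ + ⋯ + mₙ` indices one of the linear forms
belonging to it, such that `mᵢ` of the chosen forms are in group `i`: compare the coefficients of
`∏ Xᵢ^{mᵢ}` in the two expansions of `(∑ dᵢ Xᵢ)^{m₁ + ⋯ + mₙ}`. -/
theorem card_assignments {n : ℕ} (m d : Fin n → ℕ) :
    Fintype.card {σ : Fin (∑ i, m i) → Σ i, Fin (d i) //
        ∀ i, (Finset.univ.filter fun j => (σ j).1 = i).card = m i} =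
      (∑ i, m i).factorial / (∏ i, (m i).factorial) * ∏ i, d i ^ m i := by
  classical
  let s : Fin n →₀ ℕ := Finsupp.equivFunOnFinite.symm m
  have hs : s.sum (fun _ k => k) = ∑ i, m i := by
    rw [Finsupp.sum_fintype _ _ fun _ => rfl]
    rfl
  have h1 := coeff_linearCombination_X_pow_of_fintype (R := ℕ) d s (∑ i, m i)
  rw [if_pos hs, Finsupp.multinomial_eq_of_support_subset (Finset.subset_univ _),
    Finsupp.prod_fintype _ _ fun _ => pow_zero _] at h1
  have h2 : (∑ i, d i • X i : MvPolynomial (Fin n) ℕ) = ∑ q : Σ i, Fin (d i), X q.1 := by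
    rw [Fintype.sum_sigma]
    simp
  rw [h2, Fintype.sum_pow, coeff_sum] at h1
  rw [Fintype.card_subtype, Finset.card_filter]
  refine Eq.trans (Finset.sum_congr rfl fun σ _ => ?_) h1
  have h3 : ∏ j, (X (σ j).1 : MvPolynomial (Fin n) ℕ) =
      monomial (∑ j, Finsupp.single (σ j).1 1) 1 := by
    rw [MvPolynomial.monomial_sum_one]
    rfl
  rw [h3, coeff_monomial]
  congr 1
  rw [eq_iff_iff, DFunLike.ext_iff]
  refine forall_congr' fun i => ?_
  rw [Finset.card_filter, Finsupp.finsetSum_apply]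
  simp [s, Finsupp.single_apply]

section Counts

variable {n : ℕ} {m d : Fin n → ℕ}

/-- A system with real nodes. -/
noncomputable def realNodes (m d : Fin n → ℕ) : NodeSystem m d (Fin (∑ i, m i)) where
  node := fun _ p => (((finProdFinEquiv p : ℕ) : ℝ) : ℂ)
  injective := by
    intro i p q h
    have h1 : (finProdFinEquiv p : ℕ) = finProdFinEquiv q :=
      Nat.cast_injective (Complex.ofReal_injective h)
    exact finProdFinEquiv.injective (Fin.ext h1)
  card_eq := Fintype.card_fin _
  conjIndex := id
  conj_node := fun i j => ⟨Equiv.refl _, fun l => Complex.conj_ofReal _⟩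

/-- For real nodes, every assignment of linear forms to the indices gives a real point. -/
theorem le_encard_realIntersection_realNodes (hd : ∀ i, 1 ≤ d i) :
    (((∑ i, m i).factorial / (∏ i, (m i).factorial) * ∏ i, d i ^ m i : ℕ) : ℕ∞) ≤
      (realIntersection (segreVeronese m d)
        (LinearMap.ker (realNodes m d).linearMap)).encard := by
  classical
  set t := realNodes m d
  have hex := fun σ : {σ : Fin (∑ i, m i) → Σ i, Fin (d i) //
      ∀ i, (Finset.univ.filter fun j => (σ j).1 = i).card = m i} =>
    t.exists_real_zero σ.2 (fun _ p => ((finProdFinEquiv p : ℕ) : ℝ)) fun _ _ => rfl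
  choose y hy hz using hex
  let x := fun σ i s => (y σ i s : ℂ)
  have hx : ∀ σ i, x σ i ≠ 0 := hy
  have hxz : ∀ σ j, (j, (σ.1 j).2) ∈ t.zeros (x σ) (σ.1 j).1 ∧ t.form j (x σ) = 0 := hz
  let f := fun σ => Projectivization.mk ℂ (monomialVector m d (x σ))
    (monomialVector_ne_zero m d (x σ) (hx σ))
  have hf : Function.Injective f := by
    intro σ σ' h
    rw [Projectivization.mk_eq_mk_iff'] at h
    obtain ⟨c, hc⟩ := h
    apply Subtype.ext
    funext j
    refine (t.card_zeros_and_unique (hx σ) fun j => (hxz σ j).2).2 j _ _ (hxz σ j).1 ?_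
    obtain ⟨e, he, hxe⟩ := exists_smul_eq_of_monomialVector hd (hx σ) hc.symm (σ'.1 j).1
    have h1 := t.mem_zeros.1 (hxz σ' j).1
    rw [t.mem_zeros, hxe, evalNode_smul, h1, mul_zero]
  have hsub : Set.range f ⊆ realIntersection (segreVeronese m d) (LinearMap.ker t.linearMap) := by
    rintro _ ⟨σ, rfl⟩
    refine ⟨⟨x σ, hx σ, rfl⟩, ?_, ?_⟩
    · rw [Projectivization.submodule_mk, Submodule.span_singleton_le_iff_mem, LinearMap.mem_ker]
      funext j
      rw [t.linearMap_apply, t.sum_coeff_mul, (hxz σ j).2, Pi.zero_apply]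
    · have hreal : (fun α => ((∏ i, ∏ s, y σ i s ^ (α i : Fin (m i + 1) → ℕ) s : ℝ) : ℂ)) =
          monomialVector m d (x σ) := by
        funext α
        simp [monomialVector, x]
      refine ⟨_, by rw [hreal]; exact monomialVector_ne_zero m d (x σ) (hx σ), ?_⟩
      simp only [hreal, f]
  rw [← card_assignments, ← Nat.card_eq_fintype_card, ← ENat.card_eq_coe_natCard]
  exact hf.encard_range.trans (Set.encard_le_encard hsub)

/-- A system in which the nodes belonging to an index and a group with `dᵢ` even come in pairs of
nonreal complex conjugates. -/
noncomputable def verticalNodes (m d : Fin n → ℕ) : NodeSystem m d (Fin (∑ i, m i)) where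
  node := fun i p => ⟨(p.1 : ℕ), 2 * (p.2 : ℕ) + 1 - d i⟩
  injective := by
    rintro i ⟨j, l⟩ ⟨j', l'⟩ h
    have h1 := congrArg Complex.re h
    have h2 := congrArg Complex.im h
    simp only [Nat.cast_inj, sub_left_inj, add_left_inj] at h1 h2
    have h3 : (l : ℕ) = l' := by
      have : (l : ℝ) = (l' : ℕ) := by linarith
      exact_mod_cast this
    exact Prod.ext (Fin.ext h1) (Fin.ext h3)
  card_eq := Fintype.card_fin _
  conjIndex := id
  conj_node := fun i j => ⟨Fin.revPerm, fun l => by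
    apply Complex.ext
    · simp
    · have h : ((Fin.rev l : ℕ) : ℝ) = d i - (l + 1) := by
        rw [Fin.val_rev, Nat.cast_sub l.2]
        simp
      simp only [Complex.conj_im, Fin.revPerm_apply, h]
      ring⟩

/-- A system in which the families of nodes belonging to the indices `(a, true)` and `(a, false)`
are complex conjugate. -/
noncomputable def pairedNodes (m d : Fin n → ℕ) (h e : ℕ) (he : 2 * h + e = ∑ i, m i) :
    NodeSystem m d (Fin h × Bool ⊕ Fin e) where
  node := fun i p => match p with
    | (Sum.inl (a, true), l) => ⟨(a : ℕ), (l : ℕ) + 1⟩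
    | (Sum.inl (a, false), l) => ⟨(a : ℕ), -((l : ℕ) + 1)⟩
    | (Sum.inr b, l) => ⟨h + (b : ℕ), 2 * (l : ℕ) + 1 - d i⟩
  injective := by
    rintro i ⟨⟨a, _ | _⟩ | b, l⟩ ⟨⟨a', _ | _⟩ | b', l'⟩ H
    all_goals
      have h1 := congrArg Complex.re H
      have h2 := congrArg Complex.im H
      dsimp only at h1 h2
    · have h3 : (a : ℕ) = a' := by exact_mod_cast h1
      have h4 : (l : ℕ) = l' := by exact_mod_cast add_right_cancel (neg_injective h2)
      rw [Fin.ext h3, Fin.ext h4]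
    · have h3 : -((l : ℤ) + 1) = l' + 1 := by exact_mod_cast h2
      omega
    · have h3 : (a : ℕ) = h + b' := by exact_mod_cast h1
      omega
    · have h3 : (l : ℤ) + 1 = -(l' + 1) := by exact_mod_cast h2
      omega
    · have h3 : (a : ℕ) = a' := by exact_mod_cast h1
      have h4 : (l : ℕ) = l' := by exact_mod_cast add_right_cancel h2
      rw [Fin.ext h3, Fin.ext h4]
    · have h3 : (a : ℕ) = h + b' := by exact_mod_cast h1
      omega
    · have h3 : h + b = (a' : ℕ) := by exact_mod_cast h1
      omega
    · have h3 : h + b = (a' : ℕ) := by exact_mod_cast h1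
      omega
    · have h3 : (b : ℕ) = b' := by exact_mod_cast add_left_cancel h1
      have h4 : (2 : ℤ) * l + 1 - d i = 2 * l' + 1 - d i := by exact_mod_cast h2
      rw [Fin.ext h3, Fin.ext (show (l : ℕ) = l' by omega)]
  card_eq := by
    rw [← he]
    simp
    omega
  conjIndex := Sum.map (Prod.map id not) id
  conj_node := by
    rintro i (⟨a, _ | _⟩ | b)
    · exact ⟨Equiv.refl _, fun l => by apply Complex.ext <;> simp⟩
    · exact ⟨Equiv.refl _, fun l => by apply Complex.ext <;> simp⟩
    · refine ⟨Fin.revPerm, fun l => ?_⟩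
      apply Complex.ext
      · simp
      · have h : ((Fin.rev l : ℕ) : ℝ) = d i - (l + 1) := by
          rw [Fin.val_rev, Nat.cast_sub l.2]
          simp
        simp only [Complex.conj_im, Fin.revPerm_apply, Sum.map_inr, id, h]
        ring

theorem isGreatest_possibleRealCounts (hd : ∀ i, 1 ≤ d i) :
    IsGreatest (possibleRealCounts (segreVeronese m d))
      ((∑ i, m i).factorial / (∏ i, (m i).factorial) * ∏ i, d i ^ m i) := by
  constructor
  · refine (realNodes m d).mem_possibleRealCounts hd (le_antisymm ?_ ?_)
    · have h := (realNodes m d).finrank_ker hd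
      rw [varietyDim_segreVeronese m d hd] at h
      exact encard_realIntersection_le hd h ((realNodes m d).intersectsTransversely_ker hd)
    · exact le_encard_realIntersection_realNodes hd
  · rintro k ⟨W, -, hdim, hW, hk⟩
    rw [varietyDim_segreVeronese m d hd] at hdim
    have h := encard_realIntersection_le hd hdim hW
    rw [hk] at h
    exact_mod_cast h

/-- If no common zero has a conjugation-closed set of vanishing linear forms, the section has no
real points. -/
theorem isLeast_zero_of_no_conj_closed_zero {J : Type} [Fintype J] (hd : ∀ i, 1 ≤ d i)
    (t : NodeSystem m d J)
    (h : ∀ x : (i : Fin n) → Fin (m i + 1) → ℂ, (∀ i, x i ≠ 0) → (∀ j, t.form j x = 0) →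
      ¬ ∀ i a b, t.node i b = starRingEnd ℂ (t.node i a) → a ∈ t.zeros x i → b ∈ t.zeros x i) :
    IsLeast (possibleRealCounts (segreVeronese m d)) 0 := by
  refine ⟨t.mem_possibleRealCounts hd ?_, fun k _ => Nat.zero_le k⟩
  rw [Nat.cast_zero, Set.encard_eq_zero, Set.eq_empty_iff_forall_notMem]
  intro p hp
  obtain ⟨x, hx, h0, hc⟩ := t.exists_of_mem_realIntersection hd hp
  exact h x hx h0 hc

theorem isLeast_zero_of_even (hd : ∀ i, 1 ≤ d i) {i : Fin n} (hm : 1 ≤ m i) (he : Even (d i)) :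
    IsLeast (possibleRealCounts (segreVeronese m d)) 0 := by
  refine isLeast_zero_of_no_conj_closed_zero hd (verticalNodes m d) fun x hx h0 hc => ?_
  obtain ⟨hcard, huniq⟩ := (verticalNodes m d).card_zeros_and_unique hx h0
  -- A vanishing linear form in group `i` is accompanied by its conjugate, which is a different
  -- linear form with the same index.
  obtain ⟨⟨j, l⟩, hl⟩ : ((verticalNodes m d).zeros x i).Nonempty := by
    rw [← Finset.card_pos, hcard]
    exact hm
  have hrev : (j, Fin.rev l) ∈ (verticalNodes m d).zeros x i := by
    refine hc i (j, l) _ ?_ hl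
    apply Complex.ext
    · simp [verticalNodes]
    · have h : ((Fin.rev l : ℕ) : ℝ) = d i - (l + 1) := by
        rw [Fin.val_rev, Nat.cast_sub l.2]
        simp
      simp only [verticalNodes, Complex.conj_im, h]
      ring
  have h1 := huniq j ⟨i, l⟩ ⟨i, Fin.rev l⟩ hl hrev
  have h2 : l = Fin.rev l := eq_of_heq (Sigma.mk.inj h1).2
  have h3 := congrArg Fin.val h2
  rw [Fin.val_rev] at h3
  obtain ⟨k, hk⟩ := he
  have := l.2
  omega

/-- In a system of paired nodes, the vanishing linear forms of a group come in conjugate pairs at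
a real point, unless an unpaired index is involved. -/
theorem even_of_pairedNodes {h e : ℕ} (he : 2 * h + e = ∑ i, m i)
    {x : (i : Fin n) → Fin (m i + 1) → ℂ} (hx : ∀ i, x i ≠ 0)
    (h0 : ∀ j, (pairedNodes m d h e he).form j x = 0)
    (hc : ∀ i a b, (pairedNodes m d h e he).node i b =
      starRingEnd ℂ ((pairedNodes m d h e he).node i a) →
        a ∈ (pairedNodes m d h e he).zeros x i → b ∈ (pairedNodes m d h e he).zeros x i)
    {i : Fin n} (hi : ∀ b l, (Sum.inr b, l) ∉ (pairedNodes m d h e he).zeros x i) :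
    Even (m i) := by
  rw [← ((pairedNodes m d h e he).card_zeros_and_unique hx h0).1 i,
    ← ZMod.natCast_eq_zero_iff_even, Finset.cast_card]
  refine Finset.sum_involution (fun p _ => (Sum.map (Prod.map id not) id p.1, p.2)) ?_ ?_ ?_ ?_
  · intro _ _
    decide
  · rintro ⟨⟨a, b⟩ | b, l⟩ hp - hp'
    · simp at hp'
    · exact hi b l hp
  · rintro ⟨⟨a, b⟩ | b, l⟩ hp
    · refine hc i _ _ ?_ hp
      cases b <;> apply Complex.ext <;> simp [pairedNodes]
    · exact (hi b l hp).elim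
  · rintro ⟨⟨a, b⟩ | b, l⟩ hp <;> simp

theorem isLeast_zero_of_odd (hd : ∀ i, 1 ≤ d i)
    (h : (Even (∑ i, m i) ∧ ∃ i, Odd (m i)) ∨
      (Odd (∑ i, m i) ∧ ∃ i j, i ≠ j ∧ Odd (m i) ∧ Odd (m j))) :
    IsLeast (possibleRealCounts (segreVeronese m d)) 0 := by
  rcases h with ⟨⟨h, hh⟩, i, hi⟩ | ⟨⟨h, hh⟩, i, i', hne, hi, hi'⟩
  · have he : 2 * h + 0 = ∑ i, m i := by omega
    refine isLeast_zero_of_no_conj_closed_zero hd (pairedNodes m d h 0 he) fun x hx h0 hc => ?_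
    exact Nat.not_even_iff_odd.2 hi (even_of_pairedNodes he hx h0 hc fun b => b.elim0)
  · have he : 2 * h + 1 = ∑ i, m i := hh.symm
    refine isLeast_zero_of_no_conj_closed_zero hd (pairedNodes m d h 1 he) fun x hx h0 hc => ?_
    have hex : ∀ i, Odd (m i) →
        ∃ l, (Sum.inr 0, l) ∈ (pairedNodes m d h 1 he).zeros x i := by
      intro i hi
      by_contra hno
      refine Nat.not_even_iff_odd.2 hi (even_of_pairedNodes he hx h0 hc fun b l hl => hno ⟨l, ?_⟩)
      rwa [Subsingleton.elim 0 b]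
    -- The unpaired index would have vanishing linear forms in two groups.
    obtain ⟨l, hl⟩ := hex i hi
    obtain ⟨l', hl'⟩ := hex i' hi'
    have h1 := ((pairedNodes m d h 1 he).card_zeros_and_unique hx h0).2 _ ⟨i, l⟩ ⟨i', l'⟩ hl hl'
    exact hne (congrArg Sigma.fst h1)

end Counts

theorem mainTheorem3 (n : ℕ) (m d : Fin n → ℕ) (hd : ∀ i, 1 ≤ d i) :
    (IsGreatest (possibleRealCounts (segreVeronese m d))
        ((∑ i, m i).factorial / (∏ i, (m i).factorial) * ∏ i, d i ^ m i) ∧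
      varietyDegree (segreVeronese m d) =
        ((∑ i, m i).factorial : ℚ) / (∏ i, ((m i).factorial : ℚ)) * ∏ i, (d i : ℚ) ^ m i) ∧
    ((∃ i, 1 ≤ m i ∧ Even (d i)) → IsLeast (possibleRealCounts (segreVeronese m d)) 0) ∧
    ((∀ i, Odd (d i)) →
      ((Even (∑ i, m i) ∧ ∃ i, Odd (m i)) ∨
        (Odd (∑ i, m i) ∧ ∃ i j, i ≠ j ∧ Odd (m i) ∧ Odd (m j))) →
      IsLeast (possibleRealCounts (segreVeronese m d)) 0) :=
  ⟨⟨isGreatest_possibleRealCounts hd, varietyDegree_segreVeronese m d hd⟩,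
    fun ⟨_, hm, he⟩ => isLeast_zero_of_even hd hm he, fun _ h => isLeast_zero_of_odd hd h⟩
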